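/- Let $n\ge 2$ and let $d=(d(1),\dots,d(n))$ be a degree sequence with $3\le d(i)\le 4$ for all $i$ and with even sum $\sum_i d(i)=2\nu$. Choose a configuration, i.e. a function $\varphi:\{1,\dots,2\nu\}\to\{1,\dots,n\}$ with $|\varphi^{-1}(i)|=d(i)$ for every $i$, uniformly at random, and let $G$ be the multigraph on $\{1,\dots,n\}$ with the $\nu$ edges $\{\varphi(2j-1),\varphi(2j)\}$, $j=1,\dots,\nu$, conditioned on having no loops (parallel edges are allowed). Then $G$ has a (near-)perfect matching, i.e. a matching of size $\lfloor n/2\rfloor$, with probability $1-O(n^{-3/4})$; that is, there is an absolute constant $C$, independent of $n$ and of $d$, such that this probability is at least $1-Cn^{-3/4}$ for all such $n$ and $d$. -/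

import Mathlib

/-- The configurations with degree sequence `d` on the `2 * ν` configuration points:
the functions `φ` from points to vertices with exactly `d i` points over each vertex `i`. -/
def configurations {n : ℕ} (d : Fin n → ℕ) (ν : ℕ) : Set (Fin (2 * ν) → Fin n) :=
  {φ | ∀ i, (Finset.univ.filter fun w => φ w = i).card = d i}

/-- The first of the two points that form the `j`-th edge (points are numbered from `0`). -/
def firstPoint {ν : ℕ} (j : Fin ν) : Fin (2 * ν) := ⟨2 * j, by omega⟩

/-- The second of the two points that form the `j`-th edge. -/
def secondPoint {ν : ℕ} (j : Fin ν) : Fin (2 * ν) := ⟨2 * j + 1, by omega⟩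

/-- The multigraph of `φ`: its vertex set is `Fin n`, and it has `ν` edges, the `j`-th one
joining the images of the points `2 * j` and `2 * j + 1`. Loops and parallel edges may occur. -/
def configGraph {n ν : ℕ} (φ : Fin (2 * ν) → Fin n) : Graph (Fin n) (Fin ν) where
  vertexSet := Set.univ
  IsLink j x y := s(φ (firstPoint j), φ (secondPoint j)) = s(x, y)
  isLink_symm := fun _ _ => ⟨fun _ _ h => h.trans Sym2.eq_swap⟩
  eq_or_eq_of_isLink_of_isLink := by
    intro e x y v w h h'
    have := h.symm.trans h'
    rw [Sym2.eq_iff] at this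
    tauto
  left_mem_of_isLink := fun _ _ _ _ => Set.mem_univ _

/-- A matching of a multigraph: a finite set of edges, none of them a loop, such that no vertex
is incident to two of them. -/
def Graph.IsEdgeMatching {α β : Type*} (G : Graph α β) (M : Finset β) : Prop :=
  (∀ e ∈ M, e ∈ G.edgeSet ∧ ∀ x, ¬ G.IsLoopAt e x) ∧
    ∀ e ∈ M, ∀ f ∈ M, ∀ x, G.Inc e x → G.Inc f x → e = f

/-- A (near-)perfect matching exists: a matching of size `⌊|V| / 2⌋`
(for a finite vertex set). -/
def Graph.HasNearPerfectMatching {α β : Type*} (G : Graph α β) : Prop :=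
  ∃ M : Finset β, G.IsEdgeMatching M ∧ M.card = G.vertexSet.ncard / 2

/-- The law of a uniformly random configuration with degree sequence `d`. -/
noncomputable def configLaw {n : ℕ} (d : Fin n → ℕ) (ν : ℕ) :
    MeasureTheory.Measure (Fin (2 * ν) → Fin n) :=
  ProbabilityTheory.uniformOn (configurations d ν)

/-- The law of a uniformly random configuration with degree sequence `d`, conditioned on the
event that its multigraph has no loops. -/
noncomputable def looplessConfigLaw {n : ℕ} (d : Fin n → ℕ) (ν : ℕ) :
    MeasureTheory.Measure (Fin (2 * ν) → Fin n) :=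
  ProbabilityTheory.cond (configLaw d ν) {φ | (configGraph φ).Loopless}

/-! If there is no near-perfect matching, Tutte's theorem (applied to a cone when n is odd) gives a
barrier: a set S together with at least |S| + 2 disjoint odd pieces, each a union of components of
the rest. Among all barriers, take one with S largest and then with as few vertices as possible in
the pieces. Its pieces are singletons or have minimum degree at least two, so every piece A that is
not a singleton spans at least |A| edges. `hasNearPerfectMatching_of_expansion` shows that expansion
rules this out, in two cases.

If |S| is linear in n, few pieces are not singletons: small sets with as many edges as vertices are
rare, and at most n/K pieces have more than K vertices. The singletons then form an independent set
T, not much smaller than S, whose edges all go to S. If |S| is smaller, every piece has at most 4|S|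
boundary edges, so all but at most one piece are small. The union of S with |S| + 1 small pieces
then spans too many edges.

The four expansion properties are first moment estimates. They rest on the symmetry of the
configuration under permutations of points (`confProb_over_mul`). For sets of linear size, a
reciprocal binomial coefficient is bounded through the mode of a binomial distribution
(`one_le_succ_mul_choose_mul`). The estimate becomes a product of vertex weights, so the sum over
all vertex sets factorises into a product of n factors. Each factor is bounded by a constant below
1; for independent sets this needs an exponential tilt (`exists_tilt`).

Finally, a configuration is loopless with probability bounded below, by Markov's inequality and a
switching argument, so conditioning costs only a constant factor. The failure probability obtained
is O(1/n), which implies the stated rate. -/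

open Finset

/-! ### Barriers and Tutte's theorem -/

/-- A barrier: a vertex set `S` together with at least `|S| + 2` pairwise disjoint sets of odd
size that are unions of components of `G - S`. -/
structure SimpleGraph.IsBarrier {V : Type*} (G : SimpleGraph V) (S : Finset V)
    (𝒞 : Finset (Finset V)) : Prop where
  odd : ∀ A ∈ 𝒞, Odd A.card
  disj : ∀ A ∈ 𝒞, Disjoint A S
  pair : ∀ A ∈ 𝒞, ∀ B ∈ 𝒞, A ≠ B → Disjoint A B
  closed : ∀ A ∈ 𝒞, ∀ x ∈ A, ∀ y, G.Adj x y → y ∈ A ∨ y ∈ S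
  card : S.card + 2 ≤ 𝒞.card

/-- Local surgery inside one piece: part of `A` may move into S while odd closed subsets of `A` take
its place, provided that each vertex added to S is paid for by one extra piece. -/
theorem SimpleGraph.IsBarrier.replace {V : Type*} [DecidableEq V] {G : SimpleGraph V}
    {S S' : Finset V} {𝒞 𝒟 : Finset (Finset V)} (h : G.IsBarrier S 𝒞) {A : Finset V} (hA : A ∈ 𝒞)
    (hS : S ⊆ S') (hS' : S' ⊆ S ∪ A) (hsub : ∀ D ∈ 𝒟, D ⊆ A) (hodd : ∀ D ∈ 𝒟, Odd D.card)
    (hdisj : ∀ D ∈ 𝒟, Disjoint D S')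
    (hpair : ∀ D ∈ 𝒟, ∀ E ∈ 𝒟, D ≠ E → Disjoint D E)
    (hclosed : ∀ D ∈ 𝒟, ∀ x ∈ D, ∀ y, G.Adj x y → y ∈ D ∨ y ∈ S')
    (hcard : S'.card + 1 ≤ S.card + 𝒟.card) :
    G.IsBarrier S' (𝒞.erase A ∪ 𝒟) := by
  have key : ∀ B ∈ 𝒞.erase A, ∀ D ∈ 𝒟, Disjoint B D := fun B hB D hD =>
    (h.pair B (mem_of_mem_erase hB) A hA (ne_of_mem_erase hB)).mono_right (hsub D hD)
  refine ⟨?_, ?_, ?_, ?_, ?_⟩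
  · intro B hB
    rcases mem_union.1 hB with hB | hB
    · exact h.odd B (mem_of_mem_erase hB)
    · exact hodd B hB
  · intro B hB
    rcases mem_union.1 hB with hB | hB
    · refine Disjoint.mono_right hS' (disjoint_union_right.2 ⟨h.disj B (mem_of_mem_erase hB), ?_⟩)
      exact h.pair B (mem_of_mem_erase hB) A hA (ne_of_mem_erase hB)
    · exact hdisj B hB
  · intro B hB D hD hne
    rcases mem_union.1 hB with hB | hB <;> rcases mem_union.1 hD with hD | hD
    · exact h.pair B (mem_of_mem_erase hB) D (mem_of_mem_erase hD) hne
    · exact key B hB D hD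
    · exact (key D hD B hB).symm
    · exact hpair B hB D hD hne
  · intro B hB x hx y hxy
    rcases mem_union.1 hB with hB | hB
    · exact (h.closed B (mem_of_mem_erase hB) x hx y hxy).imp_right fun hy => hS hy
    · exact hclosed B hB x hx y hxy
  · have hd : Disjoint (𝒞.erase A) 𝒟 := by
      rw [Finset.disjoint_left]
      intro B hB hB'
      have := key B hB B hB'
      rw [disjoint_self_iff_empty] at this
      have h2 := hodd B hB'
      simp [this] at h2
    rw [card_union_of_disjoint hd, card_erase_of_mem hA]
    have := h.card
    have := card_pos.2 ⟨A, hA⟩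
    omega

/-- If there is a barrier, then there is one whose odd sets are singletons or span no vertex
of degree less than two. -/
theorem SimpleGraph.IsBarrier.exists_two_neighbors {V : Type*} [Fintype V] [DecidableEq V]
    {G : SimpleGraph V} {S₀ : Finset V} {𝒞₀ : Finset (Finset V)} (h₀ : G.IsBarrier S₀ 𝒞₀) :
    ∃ S 𝒞, G.IsBarrier S 𝒞 ∧ ∀ A ∈ 𝒞, A.card ≠ 1 → ∀ x ∈ A, ∃ y ∈ A, ∃ z ∈ A,
      y ≠ z ∧ G.Adj x y ∧ G.Adj x z := by
  classical
  obtain ⟨⟨S, 𝒞⟩, hmem, hmax⟩ := Finset.exists_max_image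
    ((Finset.univ : Finset (Finset V × Finset (Finset V))).filter fun p => G.IsBarrier p.1 p.2)
    -- A lexicographic order: the second count is at most |V|, so one more vertex in S always wins.
    (fun p => p.1.card * (Fintype.card V + 1) + (Finset.univ \ p.2.biUnion id).card)
    ⟨(S₀, 𝒞₀), by simpa using h₀⟩
  simp only [mem_filter, mem_univ, true_and, Prod.forall] at hmem hmax
  refine ⟨S, 𝒞, hmem, fun A hA h1 l hl => ?_⟩
  have hodd := hmem.odd A hA
  by_cases hiso : ∃ v ∈ A, G.Adj l v
  · obtain ⟨v, hv, hlv⟩ := hiso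
    by_contra hcon
    push Not at hcon
    have huniq : ∀ w ∈ A, G.Adj l w → w = v := by
      intro w hw hlw
      by_contra hne
      exact hcon w hw v hv hne hlw hlv
    have hvS : v ∉ S := Finset.disjoint_left.1 (hmem.disj A hA) hv
    have hlS : l ∉ S := Finset.disjoint_left.1 (hmem.disj A hA) hl
    have hne : l ≠ v := hlv.ne
    have hcardA : ((A.erase l).erase v).card + 2 = A.card := by
      rw [card_erase_of_mem (mem_erase.2 ⟨hne.symm, hv⟩), card_erase_of_mem hl]
      have : 1 < A.card := Finset.one_lt_card.2 ⟨l, hl, v, hv, hne⟩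
      omega
    -- Here `v` is the only neighbor of `l` inside `A`. Once `v` is in S, both `{l}` and the
    -- remainder of `A`, which is still odd, are closed; the larger S contradicts maximality.
    have hb := hmem.replace (S' := insert v S) (𝒟 := {{l}, (A.erase l).erase v}) hA
      (subset_insert _ _) ?_ ?_ ?_ ?_ ?_ ?_ ?_
    · have := hmax _ _ hb
      have hc : (insert v S).card = S.card + 1 := card_insert_of_notMem hvS
      have h3 : (univ \ 𝒞.biUnion id).card ≤ Fintype.card V := card_le_univ _
      rw [hc] at this
      nlinarith
    · intro x hx
      rcases mem_insert.1 hx with rfl | hx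
      · exact mem_union_right _ hv
      · exact mem_union_left _ hx
    · intro D hD
      simp only [mem_insert, mem_singleton] at hD
      rcases hD with rfl | rfl
      · simpa using hl
      · exact (erase_subset _ _).trans (erase_subset _ _)
    · intro D hD
      simp only [mem_insert, mem_singleton] at hD
      rcases hD with rfl | rfl
      · simp
      · rw [Nat.odd_iff] at hodd ⊢
        omega
    · intro D hD
      simp only [mem_insert, mem_singleton] at hD
      rcases hD with rfl | rfl
      · simp [hne, hlS]
      · rw [Finset.disjoint_left]
        intro x hx hx'
        simp only [mem_erase] at hx
        rcases mem_insert.1 hx' with rfl | hx'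
        · exact hx.1 rfl
        · exact Finset.disjoint_left.1 (hmem.disj A hA) hx.2.2 hx'
    · have : Disjoint {l} ((A.erase l).erase v) := by simp
      intro D hD E hE hDE
      simp only [mem_insert, mem_singleton] at hD hE
      rcases hD with rfl | rfl <;> rcases hE with rfl | rfl
      · exact absurd rfl hDE
      · exact this
      · exact this.symm
      · exact absurd rfl hDE
    · intro D hD x hx y hxy
      simp only [mem_insert, mem_singleton] at hD
      rcases hD with rfl | rfl
      · rw [mem_singleton] at hx
        subst hx
        rcases hmem.closed A hA x hl y hxy with hy | hy
        · right
          rw [huniq y hy hxy]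
          exact mem_insert_self _ _
        · right; exact mem_insert_of_mem hy
      · simp only [mem_erase] at hx
        rcases hmem.closed A hA x hx.2.2 y hxy with hy | hy
        · by_cases hyv : y = v
          · right; rw [hyv]; exact mem_insert_self _ _
          · left
            refine mem_erase.2 ⟨hyv, mem_erase.2 ⟨?_, hy⟩⟩
            rintro rfl
            exact hx.1 (huniq x hx.2.2 hxy.symm)
        · right; exact mem_insert_of_mem hy
    · have hne' : ({l} : Finset V) ≠ (A.erase l).erase v := by
        intro h
        have : l ∈ (A.erase l).erase v := by rw [← h]; simp
        simp at this
      rw [card_insert_of_notMem hvS, card_pair hne']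
  · push Not at hiso
    exfalso
    have hlS : l ∉ S := Finset.disjoint_left.1 (hmem.disj A hA) hl
    -- A vertex isolated in `A` can replace `A`: S is unchanged, and the other vertices of `A` leave
    -- the pieces.
    have hb := hmem.replace (S' := S) (𝒟 := {{l}}) hA subset_rfl subset_union_left
      (by simpa using hl) (by simp) (by simpa using hlS) (by
        intro D hD E hE hDE
        simp only [mem_singleton] at hD hE
        exact absurd (hD.trans hE.symm) hDE) (by
        intro D hD x hx y hxy
        rw [mem_singleton] at hD
        subst hD
        rw [mem_singleton] at hx
        subst hx
        rcases hmem.closed A hA x hl y hxy with hy | hy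
        · exact absurd hxy (hiso y hy)
        · exact Or.inr hy) (by simp)
    have h2 := hmax _ _ hb
    have h3 : 1 < A.card := by
      have := card_pos.2 ⟨l, hl⟩
      omega
    obtain ⟨w, hw, hwl⟩ := Finset.exists_mem_ne h3 l
    have h4 : (univ \ 𝒞.biUnion id).card < (univ \ (𝒞.erase A ∪ {{l}}).biUnion id).card := by
      apply card_lt_card
      rw [Finset.ssubset_iff_of_subset]
      · refine ⟨w, ?_, ?_⟩
        · simp only [mem_sdiff, mem_univ, true_and, mem_biUnion, mem_union, mem_singleton, id]
          rintro ⟨B, hB | rfl, hwB⟩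
          · exact Finset.disjoint_left.1
              (hmem.pair B (mem_of_mem_erase hB) A hA (ne_of_mem_erase hB)) hwB hw
          · exact hwl (mem_singleton.1 hwB)
        · simp only [mem_sdiff, mem_univ, true_and, mem_biUnion, not_not, id]
          exact ⟨A, hA, hw⟩
      · intro x hx
        simp only [mem_sdiff, mem_univ, true_and, mem_biUnion, id, mem_union, mem_singleton] at hx ⊢
        rintro ⟨B, hB | rfl, hxB⟩
        · exact hx ⟨B, mem_of_mem_erase hB, hxB⟩
        · rw [mem_singleton] at hxB
          subst hxB
          exact hx ⟨A, hA, hl⟩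
    omega

/-- **Tutte's theorem** in the form of an alternative between an involution along edges and
a barrier. -/
theorem SimpleGraph.exists_involution_or_barrier {V : Type*} [Fintype V] [DecidableEq V]
    (G : SimpleGraph V) (hV : Even (Fintype.card V)) :
    (∃ f : V → V, ∀ v, G.Adj v (f v) ∧ f (f v) = v) ∨ ∃ S 𝒞, G.IsBarrier S 𝒞 := by
  classical
  by_cases hM : ∃ M : Subgraph G, M.IsPerfectMatching
  · left
    obtain ⟨M, hM, hs⟩ := hM
    choose f hf hu using fun v => hM (hs v)
    refine ⟨f, fun v => ⟨(hf v).adj_sub, ?_⟩⟩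
    exact (hu (f v) v (hf v).symm).symm
  · right
    rw [SimpleGraph.tutte] at hM
    push Not at hM
    obtain ⟨u, hu⟩ := hM
    unfold IsTutteViolator at hu
    set H := ((⊤ : G.Subgraph).deleteVerts u).coe with hH
    have hpar := H.odd_ncard_oddComponents
    let F : H.ConnectedComponent → Finset V := fun c =>
      (Set.toFinset (Subtype.val '' c.supp))
    have hF : ∀ c x, x ∈ F c ↔ ∃ h : x ∈ ((⊤ : G.Subgraph).deleteVerts u).verts,
        H.connectedComponentMk ⟨x, h⟩ = c := by
      intro c x
      simp [F, ConnectedComponent.mem_supp_iff]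
    have hFcard : ∀ c, (F c).card = c.supp.ncard := by
      intro c
      rw [← Set.ncard_eq_toFinset_card', Set.ncard_image_of_injective _ Subtype.val_injective]
    have hFinj : ∀ c c', (∃ x, x ∈ F c ∧ x ∈ F c') → c = c' := by
      rintro c c' ⟨x, h1, h2⟩
      obtain ⟨h, h1⟩ := (hF _ _).1 h1
      obtain ⟨h', h2⟩ := (hF _ _).1 h2
      rw [← h1, ← h2]
    refine ⟨u.toFinset, H.oddComponents.toFinset.image F, ?_, ?_, ?_, ?_, ?_⟩
    · intro A hA
      obtain ⟨c, hc, rfl⟩ := mem_image.1 hA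
      rw [hFcard]
      simpa using hc
    · intro A hA
      obtain ⟨c, hc, rfl⟩ := mem_image.1 hA
      rw [Finset.disjoint_left]
      intro x hx hxu
      obtain ⟨h, -⟩ := (hF _ _).1 hx
      simp at h hxu
      exact h hxu
    · intro A hA B hB hne
      obtain ⟨c, hc, rfl⟩ := mem_image.1 hA
      obtain ⟨c', hc', rfl⟩ := mem_image.1 hB
      rw [Finset.disjoint_left]
      intro x hx hx'
      exact hne (congrArg F (hFinj c c' ⟨x, hx, hx'⟩))
    · intro A hA x hx y hxy
      obtain ⟨c, hc, rfl⟩ := mem_image.1 hA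
      obtain ⟨h, hc'⟩ := (hF _ _).1 hx
      by_cases hy : y ∈ u
      · right; simpa using hy
      · left
        have hy' : y ∈ ((⊤ : G.Subgraph).deleteVerts u).verts := by simpa using hy
        rw [hF]
        refine ⟨hy', ?_⟩
        rw [← hc', ConnectedComponent.eq]
        apply Adj.reachable
        simp only [hH, Subgraph.coe_adj, Subgraph.deleteVerts_adj]
        simp at h
        simp [h, hy, hxy.symm]
    · have hinj : (H.oddComponents.toFinset.image F).card = H.oddComponents.toFinset.card := by
        apply card_image_of_injOn
        intro c hc c' hc' hcc
        simp only [Set.coe_toFinset, Set.mem_ofPred_eq] at hc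
        have : (F c).Nonempty := by
          rw [← card_pos, hFcard]
          exact hc.pos
        obtain ⟨x, hx⟩ := this
        exact hFinj c c' ⟨x, hx, by have := hcc ▸ hx; exact this⟩
      rw [hinj, ← Set.ncard_eq_toFinset_card', ← Set.ncard_eq_toFinset_card']
      have hcV : Nat.card ((⊤ : G.Subgraph).deleteVerts u).verts + u.ncard = Fintype.card V := by
        have h1 : ((⊤ : G.Subgraph).deleteVerts u).verts = uᶜ := by
          ext x; simp
        rw [h1, Nat.card_coe_set_eq, add_comm, Set.ncard_add_ncard_compl, Nat.card_eq_fintype_card]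
      -- The number of odd components has the parity of |V ∖ u|. As |V| is even, exceeding |u| means
      -- exceeding it by at least two.
      rw [Nat.odd_iff, Nat.odd_iff] at hpar
      rw [Nat.even_iff] at hV
      omega

/-- The cone over a simple graph: a new vertex `none` is joined to all the others. -/
def SimpleGraph.optionCone {V : Type*} (G : SimpleGraph V) : SimpleGraph (Option V) where
  Adj a b := a ≠ b ∧ (a = none ∨ b = none ∨ ∃ x y, a = some x ∧ b = some y ∧ G.Adj x y)
  symm := ⟨by
    rintro a b ⟨h, h1 | h1 | ⟨x, y, hx, hy, hxy⟩⟩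
    · exact ⟨h.symm, Or.inr (Or.inl h1)⟩
    · exact ⟨h.symm, Or.inl h1⟩
    · exact ⟨h.symm, Or.inr (Or.inr ⟨y, x, hy, hx, hxy.symm⟩)⟩⟩
  loopless := ⟨fun _ h => h.1 rfl⟩

theorem SimpleGraph.optionCone_adj_some {V : Type*} {G : SimpleGraph V} {x y : V} :
    G.optionCone.Adj (some x) (some y) ↔ G.Adj x y := by
  constructor
  · rintro ⟨-, h | h | ⟨a, b, ha, hb, hab⟩⟩
    · cases h
    · cases h
    · cases ha; cases hb; exact hab
  · intro h
    exact ⟨by simpa using h.ne, Or.inr (Or.inr ⟨x, y, rfl, rfl, h⟩)⟩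

/-- The apex must lie in S: otherwise every piece, being closed and nonempty, would contain it,
although two pieces are disjoint. Deleting the apex shrinks S and leaves the pieces intact. -/
theorem SimpleGraph.IsBarrier.of_optionCone {V : Type*} [DecidableEq V] {G : SimpleGraph V}
    {S : Finset (Option V)} {𝒞 : Finset (Finset (Option V))} (h : G.optionCone.IsBarrier S 𝒞) :
    ∃ S 𝒞, G.IsBarrier S 𝒞 := by
  have hnone : none ∈ S := by
    by_contra hn
    have h2 : 1 < 𝒞.card := by have := h.card; omega
    obtain ⟨A, hA, B, hB, hne⟩ := Finset.one_lt_card.1 h2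
    have key : ∀ A ∈ 𝒞, none ∈ A := by
      intro A hA
      by_contra hnA
      obtain ⟨x, hx⟩ := card_pos.1 (h.odd A hA).pos
      rcases h.closed A hA x hx none ⟨fun hx' => hnA (hx' ▸ hx), Or.inr (Or.inl rfl)⟩ with h' | h'
      · exact hnA h'
      · exact hn h'
    exact Finset.disjoint_left.1 (h.pair A hA B hB hne) (key A hA) (key B hB)
  have hA0 : ∀ A ∈ 𝒞, none ∉ A := fun A hA hn => Finset.disjoint_left.1 (h.disj A hA) hn hnone
  have hcardE : ∀ A ∈ 𝒞, (eraseNone A).card = A.card := by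
    intro A hA
    rw [card_eraseNone_eq_card_erase, erase_eq_of_notMem (hA0 A hA)]
  refine ⟨eraseNone S, 𝒞.image eraseNone, ?_, ?_, ?_, ?_, ?_⟩
  · intro A hA
    obtain ⟨B, hB, rfl⟩ := mem_image.1 hA
    rw [hcardE B hB]
    exact h.odd B hB
  · intro A hA
    obtain ⟨B, hB, rfl⟩ := mem_image.1 hA
    rw [Finset.disjoint_left]
    intro x hx hx'
    exact Finset.disjoint_left.1 (h.disj B hB) (mem_eraseNone.1 hx) (mem_eraseNone.1 hx')
  · intro A hA A' hA' hne
    obtain ⟨B, hB, rfl⟩ := mem_image.1 hA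
    obtain ⟨B', hB', rfl⟩ := mem_image.1 hA'
    rw [Finset.disjoint_left]
    intro x hx hx'
    exact Finset.disjoint_left.1 (h.pair B hB B' hB' (fun h => hne (by rw [h])))
      (mem_eraseNone.1 hx) (mem_eraseNone.1 hx')
  · intro A hA x hx y hxy
    obtain ⟨B, hB, rfl⟩ := mem_image.1 hA
    rw [mem_eraseNone] at hx ⊢
    rw [mem_eraseNone]
    exact h.closed B hB _ hx _ (SimpleGraph.optionCone_adj_some.2 hxy)
  · rw [card_image_of_injOn, card_eraseNone_eq_card_erase, card_erase_of_mem hnone]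
    · have := h.card
      omega
    · intro A hA B hB hAB
      by_contra hne
      obtain ⟨x, hx⟩ := card_pos.1 (h.odd A hA).pos
      cases x with
      | none => exact hA0 A hA hx
      | some x =>
        have : x ∈ eraseNone B := by
          have hAB' : eraseNone A = eraseNone B := hAB
          rw [← hAB']
          exact mem_eraseNone.2 hx
        exact Finset.disjoint_left.1 (h.pair A hA B hB hne) hx (mem_eraseNone.1 this)

/-- For odd order, a perfect matching of the cone becomes a near-perfect one when the apex and its
partner are dropped. -/
theorem SimpleGraph.exists_near_perfect_or_barrier {V : Type*} [Fintype V] [DecidableEq V]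
    (G : SimpleGraph V) :
    (∃ (W : Finset V) (f : V → V), W.card / 2 = Fintype.card V / 2 ∧
      ∀ v ∈ W, f v ∈ W ∧ G.Adj v (f v) ∧ f (f v) = v) ∨ ∃ S 𝒞, G.IsBarrier S 𝒞 := by
  rcases Nat.even_or_odd (Fintype.card V) with he | ho
  · refine (G.exists_involution_or_barrier he).imp_left ?_
    rintro ⟨f, hf⟩
    exact ⟨univ, f, rfl, fun v _ => ⟨mem_univ _, hf v⟩⟩
  · have he : Even (Fintype.card (Option V)) := by
      rw [Fintype.card_option]
      exact ho.add_one
    rcases G.optionCone.exists_involution_or_barrier he with ⟨f, hf⟩ | ⟨S, 𝒞, h⟩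
    · left
      have hfn : f none ≠ none := fun h => (hf none).1.ne h.symm
      obtain ⟨w, hw⟩ := Option.ne_none_iff_exists'.1 hfn
      have hfw : f (some w) = none := by rw [← hw]; exact (hf none).2
      refine ⟨univ.erase w, fun v => (f (some v)).getD v, ?_, ?_⟩
      · rw [card_erase_of_mem (mem_univ _), card_univ]
        rw [Nat.odd_iff] at ho
        omega
      · intro v hv
        have hvw : v ≠ w := (mem_erase.1 hv).1
        have hv' : f (some v) ≠ none := by
          intro h
          have := (hf (some v)).2
          rw [h, hw] at this
          exact hvw (Option.some_injective _ this.symm)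
        obtain ⟨u, hu⟩ := Option.ne_none_iff_exists'.1 hv'
        have hfu : f (some u) = some v := by rw [← hu]; exact (hf (some v)).2
        simp only [hu, Option.getD_some, hfu, and_true]
        refine ⟨?_, ?_⟩
        · refine mem_erase.2 ⟨?_, mem_univ _⟩
          rintro rfl
          rw [hfw] at hfu
          cases hfu
        · have := (hf (some v)).1
          rw [hu] at this
          exact SimpleGraph.optionCone_adj_some.1 this
    · exact Or.inr h.of_optionCone

/-! ### From the simple graph back to matchings of the multigraph -/

/-- The simple graph underlying the multigraph of a configuration. -/
def configSimple {n ν : ℕ} (φ : Fin (2 * ν) → Fin n) : SimpleGraph (Fin n) where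
  Adj x y := x ≠ y ∧ ∃ j, s(φ (firstPoint j), φ (secondPoint j)) = s(x, y)
  symm := ⟨fun _ _ ⟨h, j, hj⟩ => ⟨h.symm, j, hj.trans Sym2.eq_swap⟩⟩
  loopless := ⟨fun _ h => h.1 rfl⟩

theorem hasNearPerfectMatching_of_involution {n ν : ℕ} (φ : Fin (2 * ν) → Fin n)
    (W : Finset (Fin n)) (f : Fin n → Fin n) (hW : W.card / 2 = n / 2)
    (hf : ∀ v ∈ W, f v ∈ W ∧ (configSimple φ).Adj v (f v) ∧ f (f v) = v) :
    (configGraph φ).HasNearPerfectMatching := by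
  classical
  have hinc : ∀ e x, (configGraph φ).Inc e x ↔ x ∈ s(φ (firstPoint e), φ (secondPoint e)) := by
    intro e x
    constructor
    · rintro ⟨y, hy⟩
      have hy : s(φ (firstPoint e), φ (secondPoint e)) = s(x, y) := hy
      rw [hy]; simp
    · intro h
      obtain ⟨y, hy⟩ := Sym2.mem_iff_exists.1 h
      exact ⟨y, hy⟩
  -- One representative among parallel edges is fixed per unordered pair, so that `v` and `f v`
  -- select the same edge; `none` serves pairs that carry no edge.
  have hE : ∀ z : Sym2 (Fin n), ∃ e : Option (Fin ν), ∀ j,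
      s(φ (firstPoint j), φ (secondPoint j)) = z → ∃ i, e = some i ∧
        s(φ (firstPoint i), φ (secondPoint i)) = z := by
    intro z
    by_cases h : ∃ j, s(φ (firstPoint j), φ (secondPoint j)) = z
    · obtain ⟨j, hj⟩ := h
      exact ⟨some j, fun _ _ => ⟨j, rfl, hj⟩⟩
    · exact ⟨none, fun j hj => absurd ⟨j, hj⟩ h⟩
  choose E hE using hE
  have hg : ∀ v ∈ W, ∃ i, E s(v, f v) = some i ∧
      s(φ (firstPoint i), φ (secondPoint i)) = s(v, f v) := by
    intro v hv
    obtain ⟨-, ⟨-, j, hj⟩, -⟩ := hf v hv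
    exact hE _ j hj
  rcases isEmpty_or_nonempty (Fin ν) with hν | hν
  · have hW0 : W = ∅ := by
      rw [Finset.eq_empty_iff_forall_notMem]
      intro v hv
      obtain ⟨i, -⟩ := hg v hv
      exact hν.elim i
    refine ⟨∅, ⟨by simp, by simp⟩, ?_⟩
    have hv : (configGraph φ).vertexSet = Set.univ := rfl
    rw [hv, Set.ncard_univ, Nat.card_eq_fintype_card, Fintype.card_fin, ← hW, hW0]
    simp
  choose! g hg1 hg2 using hg
  have hgf : ∀ v ∈ W, g (f v) = g v := by
    intro v hv
    have h1 := hg1 v hv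
    have h2 := hg1 (f v) (hf v hv).1
    rw [(hf v hv).2.2, Sym2.eq_swap, h1] at h2
    exact (Option.some_injective _ h2).symm
  have hgeq : ∀ v ∈ W, ∀ w ∈ W, g v = g w → w = v ∨ w = f v := by
    intro v hv w hw h
    have h1 := hg2 v hv
    rw [h, hg2 w hw, Sym2.eq_iff] at h1
    tauto
  refine ⟨W.image g, ⟨?_, ?_⟩, ?_⟩
  · intro e he
    obtain ⟨v, hv, rfl⟩ := mem_image.1 he
    refine ⟨⟨v, f v, hg2 v hv⟩, fun x hx => ?_⟩
    have hx : s(φ (firstPoint (g v)), φ (secondPoint (g v))) = s(x, x) := hx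
    rw [hg2 v hv, Sym2.eq_iff] at hx
    have := (hf v hv).2.1.ne
    aesop
  · intro e he e' he' x hx hx'
    obtain ⟨v, hv, rfl⟩ := mem_image.1 he
    obtain ⟨w, hw, rfl⟩ := mem_image.1 he'
    rw [hinc, hg2 v hv, Sym2.mem_iff] at hx
    rw [hinc, hg2 w hw, Sym2.mem_iff] at hx'
    have h1 : g x = g v := by
      rcases hx with rfl | rfl
      · rfl
      · exact hgf v hv
    have h2 : g x = g w := by
      rcases hx' with rfl | rfl
      · rfl
      · exact hgf w hw
    rw [← h1, ← h2]
  · have hv : (configGraph φ).vertexSet = Set.univ := rfl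
    rw [hv, Set.ncard_univ, Nat.card_eq_fintype_card, Fintype.card_fin, ← hW]
    have h2 : W.card = ∑ e ∈ W.image g, (W.filter fun v => g v = e).card :=
      card_eq_sum_card_image g W
    have h3 : ∀ e ∈ W.image g, (W.filter fun v => g v = e).card = 2 := by
      intro e he
      obtain ⟨v, hv, rfl⟩ := mem_image.1 he
      have : (W.filter fun w => g w = g v) = {v, f v} := by
        ext w
        simp only [mem_filter, mem_insert, mem_singleton]
        constructor
        · rintro ⟨hw, h⟩
          exact hgeq v hv w hw h.symm
        · rintro (rfl | rfl)
          · exact ⟨hv, rfl⟩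
          · exact ⟨(hf v hv).1, hgf v hv⟩
      rw [this, card_pair (hf v hv).2.1.ne]
    rw [sum_congr rfl h3, sum_const, smul_eq_mul] at h2
    omega

/-! ### Edge counts and the deterministic expansion criterion -/

/-- The points of a configuration, arranged into first points and second points of edges. -/
noncomputable def pointEquiv (ν : ℕ) : Fin ν ⊕ Fin ν ≃ Fin (2 * ν) :=
  Equiv.ofBijective (Sum.elim firstPoint secondPoint) (by
    constructor
    · rintro (a | a) (b | b) h <;> simp only [Sum.elim_inl, Sum.elim_inr, firstPoint, secondPoint,
        Fin.mk.injEq] at h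
      · congr 1; ext; omega
      · omega
      · omega
      · congr 1; ext; omega
    · intro w
      rcases Nat.even_or_odd' (w : ℕ) with ⟨c, hc | hc⟩
      · exact ⟨Sum.inl ⟨c, by omega⟩, by ext; simp [firstPoint, hc]⟩
      · exact ⟨Sum.inr ⟨c, by omega⟩, by ext; simp [secondPoint, hc]⟩)

theorem sum_points {ν : ℕ} {M : Type*} [AddCommMonoid M] (f : Fin (2 * ν) → M) :
    ∑ w, f w = ∑ j, (f (firstPoint j) + f (secondPoint j)) := by
  rw [← (pointEquiv ν).sum_comp, Fintype.sum_sum_type, sum_add_distrib]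
  rfl

/-- The edges of a configuration with both ends in `A`. -/
def innerEdges {n ν : ℕ} (φ : Fin (2 * ν) → Fin n) (A : Finset (Fin n)) : Finset (Fin ν) :=
  univ.filter fun j => φ (firstPoint j) ∈ A ∧ φ (secondPoint j) ∈ A

/-- The edges of a configuration with at least one end in `A`. -/
def touchingEdges {n ν : ℕ} (φ : Fin (2 * ν) → Fin n) (A : Finset (Fin n)) : Finset (Fin ν) :=
  univ.filter fun j => φ (firstPoint j) ∈ A ∨ φ (secondPoint j) ∈ A

/-- All edges with an end in `T` have the other end in `S`. -/
def EdgesGoTo {n ν : ℕ} (φ : Fin (2 * ν) → Fin n) (T S : Finset (Fin n)) : Prop :=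
  ∀ j, (φ (firstPoint j) ∈ T → φ (secondPoint j) ∈ S) ∧
    (φ (secondPoint j) ∈ T → φ (firstPoint j) ∈ S)

theorem card_points_over {n ν : ℕ} {d : Fin n → ℕ} {φ : Fin (2 * ν) → Fin n}
    (hφ : φ ∈ configurations d ν) (A : Finset (Fin n)) :
    (univ.filter fun w => φ w ∈ A).card = ∑ i ∈ A, d i := by
  rw [card_eq_sum_card_fiberwise (f := φ) (t := A) (fun w hw => by simpa using hw)]
  refine sum_congr rfl fun i hi => ?_
  rw [← hφ i, filter_filter]
  congr 1
  ext w
  simp only [mem_filter, mem_univ, true_and, and_iff_right_iff_imp]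
  rintro rfl
  exact hi

theorem innerEdges_subset_touchingEdges {n ν : ℕ} (φ : Fin (2 * ν) → Fin n) (A : Finset (Fin n)) :
    innerEdges φ A ⊆ touchingEdges φ A := by
  intro j hj
  simp only [innerEdges, touchingEdges, mem_filter, mem_univ, true_and] at hj ⊢
  exact Or.inl hj.1

/-- An edge inside `A` accounts for two points over `A`, any other edge touching `A` for one. -/
theorem card_innerEdges_add_card_touchingEdges {n ν : ℕ} {d : Fin n → ℕ}
    {φ : Fin (2 * ν) → Fin n} (hφ : φ ∈ configurations d ν) (A : Finset (Fin n)) :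
    (innerEdges φ A).card + (touchingEdges φ A).card = ∑ i ∈ A, d i := by
  rw [← card_points_over hφ, card_filter, sum_points, innerEdges, touchingEdges, card_filter,
    card_filter, ← sum_add_distrib]
  refine sum_congr rfl fun j _ => ?_
  by_cases h1 : φ (firstPoint j) ∈ A <;> by_cases h2 : φ (secondPoint j) ∈ A <;> simp [h1, h2]

/-- A set in which every vertex has two neighbors spans at least as many edges as vertices. -/
theorem card_le_card_innerEdges {n ν : ℕ} (φ : Fin (2 * ν) → Fin n) (A : Finset (Fin n))
    (h : ∀ x ∈ A, ∃ y ∈ A, ∃ z ∈ A, y ≠ z ∧ (configSimple φ).Adj x y ∧ (configSimple φ).Adj x z) :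
    A.card ≤ (innerEdges φ A).card := by
  classical
  have key := card_mul_le_card_mul (s := A) (t := innerEdges φ A) (m := 2) (n := 2)
    (fun x j => x ∈ s(φ (firstPoint j), φ (secondPoint j))) ?_ ?_
  · omega
  · intro x hx
    obtain ⟨y, hy, z, hz, hyz, ⟨hxy, j, hj⟩, ⟨hxz, k, hk⟩⟩ := h x hx
    have hin : ∀ w ∈ A, ∀ j, s(φ (firstPoint j), φ (secondPoint j)) = s(x, w) →
        j ∈ innerEdges φ A := by
      intro w hw j hj
      simp only [innerEdges, mem_filter, mem_univ, true_and]
      rw [Sym2.eq_iff] at hj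
      rcases hj with ⟨h1, h2⟩ | ⟨h1, h2⟩ <;> rw [h1, h2] <;> exact ⟨by assumption, by assumption⟩
    have hjk : j ≠ k := by
      rintro rfl
      rw [hj, Sym2.eq_iff] at hk
      aesop
    rw [← card_pair hjk]
    apply card_le_card
    intro i hi
    rw [mem_bipartiteAbove]
    rcases mem_insert.1 hi with rfl | hi
    · exact ⟨hin y hy _ hj, by rw [hj]; simp⟩
    · rw [mem_singleton] at hi
      subst hi
      exact ⟨hin z hz _ hk, by rw [hk]; simp⟩
  · intro j _
    refine (card_le_card (t := {φ (firstPoint j), φ (secondPoint j)}) ?_).trans card_le_two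
    intro x hx
    rw [mem_bipartiteBelow] at hx
    simpa using hx.2

theorem exists_card_sub_one_filter {α : Type*} [DecidableEq α] (s : Finset α) (p : α → Prop)
    [DecidablePred p] (h : ∀ a ∈ s, ∀ b ∈ s, ¬ p a → ¬ p b → a = b) :
    s.card ≤ (s.filter p).card + 1 := by
  have h1 : (s.filter fun a => ¬ p a).card ≤ 1 := by
    rw [card_le_one]
    intro a ha b hb
    rw [mem_filter] at ha hb
    exact h a ha.1 b hb.1 ha.2 hb.2
  have := card_filter_add_card_filter_not (s := s) p
  omega

/-- The expansion properties that force a near perfect matching in a loopless configuration. -/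
theorem hasNearPerfectMatching_of_expansion {n ν : ℕ} {d : Fin n → ℕ}
    (hd : ∀ i, 3 ≤ d i ∧ d i ≤ 4) (hsum : ∑ i, d i = 2 * ν)
    {φ : Fin (2 * ν) → Fin n} (hφ : φ ∈ configurations d ν)
    (hloop : ∀ j, φ (firstPoint j) ≠ φ (secondPoint j))
    {x₀ s₀ μ α r₀ r₁ r₂ : ℝ} {K : ℕ} (hsμ : 4 * s₀ ≤ μ)
    (hαx : α * (2 * ν) ≤ 3 * x₀) (hsx : 25 * (s₀ + 1) ≤ x₀) (hKr : (n : ℝ) ≤ K * r₂)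
    (hK : 0 < K) (hr : r₁ + r₂ ≤ r₀)
    (h_sparse : ∀ X : Finset (Fin n), X.Nonempty → (X.card : ℝ) ≤ x₀ →
      (innerEdges φ X).card < X.card + max 2 ((X.card + 24) / 25))
    (h_conn : ∀ A : Finset (Fin n),
      ((touchingEdges φ A).card : ℝ) ≤ (innerEdges φ A).card + μ →
      ((∑ i ∈ A, d i : ℕ) : ℝ) ≤ α * (2 * ν) ∨ (1 - α) * (2 * ν) ≤ ((∑ i ∈ A, d i : ℕ) : ℝ))
    (h_cyc : ((univ.filter fun A : Finset (Fin n) =>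
      2 ≤ A.card ∧ A.card ≤ K ∧ A.card ≤ (innerEdges φ A).card).card : ℝ) ≤ r₁)
    (h_indep : ∀ S T : Finset (Fin n), Disjoint S T → EdgesGoTo φ T S → s₀ ≤ S.card →
      (T.card : ℝ) + r₀ < S.card) :
    (configGraph φ).HasNearPerfectMatching := by
  classical
  rcases (configSimple φ).exists_near_perfect_or_barrier with ⟨W, f, hW, hf⟩ | ⟨S₀, 𝒞₀, hb⟩
  · exact hasNearPerfectMatching_of_involution φ W f (by simpa using hW) hf
  exfalso
  obtain ⟨S, 𝒞, hb, htwo⟩ := hb.exists_two_neighbors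
  have hadj : ∀ j, (configSimple φ).Adj (φ (firstPoint j)) (φ (secondPoint j)) :=
    fun j => ⟨hloop j, j, rfl⟩
  have hdeg : ∀ A : Finset (Fin n), 3 * A.card ≤ ∑ i ∈ A, d i := fun A => by
    have := Finset.card_nsmul_le_sum A d 3 fun i _ => (hd i).1
    rwa [smul_eq_mul, mul_comm] at this
  have hdeg' : ∀ A : Finset (Fin n), ∑ i ∈ A, d i ≤ 4 * A.card := fun A => by
    have := Finset.sum_le_card_nsmul A d 4 fun i _ => (hd i).2
    rwa [smul_eq_mul, mul_comm] at this
  -- When S is large, the vertices of the singleton pieces form the independent set `T`, and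
  -- counting pieces contradicts `h_indep`.
  by_cases hs : s₀ ≤ S.card
  · set T := univ.filter fun x => ({x} : Finset (Fin n)) ∈ 𝒞 with hT
    have hST : Disjoint S T := by
      rw [Finset.disjoint_left]
      intro x hx hxT
      simp only [hT, mem_filter, mem_univ, true_and] at hxT
      have := hb.disj _ hxT
      simp only [disjoint_singleton_left] at this
      exact this hx
    have hgo : EdgesGoTo φ T S := by
      intro j
      constructor
      · intro h
        simp only [hT, mem_filter, mem_univ, true_and] at h
        rcases hb.closed _ h _ (mem_singleton_self _) _ (hadj j) with h' | h'
        · exact absurd (mem_singleton.1 h').symm (hloop j)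
        · exact h'
      · intro h
        simp only [hT, mem_filter, mem_univ, true_and] at h
        rcases hb.closed _ h _ (mem_singleton_self _) _ (hadj j).symm with h' | h'
        · exact absurd (mem_singleton.1 h') (hloop j)
        · exact h'
    have h1 := h_indep S T hST hgo hs
    have hcov : 𝒞 ⊆ T.image (fun x => ({x} : Finset (Fin n))) ∪
        ((univ.filter fun A : Finset (Fin n) =>
          2 ≤ A.card ∧ A.card ≤ K ∧ A.card ≤ (innerEdges φ A).card) ∪
          𝒞.filter fun A => K < A.card) := by
      intro A hA
      by_cases hA1 : A.card = 1
      · obtain ⟨x, rfl⟩ := card_eq_one.1 hA1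
        exact mem_union_left _ (mem_image.2 ⟨x, by simpa [hT] using hA, rfl⟩)
      · refine mem_union_right _ ?_
        by_cases hAK : A.card ≤ K
        · refine mem_union_left _ ?_
          simp only [mem_filter, mem_univ, true_and]
          refine ⟨?_, hAK, card_le_card_innerEdges φ A (htwo A hA hA1)⟩
          have := (hb.odd A hA).pos
          omega
        · refine mem_union_right _ ?_
          simp only [mem_filter]
          exact ⟨hA, by omega⟩
    have h2 : 𝒞.card ≤ T.card + ((univ.filter fun A : Finset (Fin n) =>
          2 ≤ A.card ∧ A.card ≤ K ∧ A.card ≤ (innerEdges φ A).card).card +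
          (𝒞.filter fun A => K < A.card).card) :=
      (card_le_card hcov).trans ((card_union_le _ _).trans
        (add_le_add card_image_le (card_union_le _ _)))
    have h3 : (𝒞.filter fun A => K < A.card).card * K ≤ n := by
      have h4 : (𝒞.filter fun A => K < A.card).card * K ≤
          ∑ A ∈ 𝒞.filter fun A => K < A.card, A.card := by
        have := Finset.card_nsmul_le_sum (𝒞.filter fun A => K < A.card) card K
          fun A hA => (mem_filter.1 hA).2.le
        simpa using this
      rw [← card_biUnion (fun A hA B hB hne =>
        hb.pair A (mem_filter.1 hA).1 B (mem_filter.1 hB).1 hne)] at h4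
      exact h4.trans (card_le_univ _ |>.trans (by simp))
    have h5 : ((𝒞.filter fun A => K < A.card).card : ℝ) ≤ r₂ := by
      have h3' : ((𝒞.filter fun A => K < A.card).card : ℝ) * K ≤ n := by exact_mod_cast h3
      have hK' : (0 : ℝ) < K := by exact_mod_cast hK
      nlinarith
    have h2' : (𝒞.card : ℝ) ≤ T.card + (((univ.filter fun A : Finset (Fin n) =>
          2 ≤ A.card ∧ A.card ≤ K ∧ A.card ≤ (innerEdges φ A).card).card : ℝ) +
          ((𝒞.filter fun A => K < A.card).card : ℝ)) := by exact_mod_cast h2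
    have h6 : (S.card : ℝ) + 2 ≤ 𝒞.card := by exact_mod_cast hb.card
    linarith
  · push Not at hs
    set bd : Finset (Fin n) → Finset (Fin ν) := fun A => touchingEdges φ A \ innerEdges φ A with hbd
    have hbdcard : ∀ A, (innerEdges φ A).card + (bd A).card = (touchingEdges φ A).card := by
      intro A
      have := card_sdiff_add_card_eq_card (innerEdges_subset_touchingEdges φ A)
      simp only [hbd]; omega
    have hbdS : ∀ A ∈ 𝒞, ∀ j ∈ bd A, (φ (firstPoint j) ∈ A ∧ φ (secondPoint j) ∈ S) ∨
        (φ (firstPoint j) ∈ S ∧ φ (secondPoint j) ∈ A) := by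
      intro A hA j hj
      simp only [hbd, innerEdges, touchingEdges, mem_sdiff, mem_filter, mem_univ, true_and] at hj
      obtain ⟨h1 | h1, h2⟩ := hj
      · rcases hb.closed A hA _ h1 _ (hadj j) with h | h
        · exact absurd ⟨h1, h⟩ h2
        · exact Or.inl ⟨h1, h⟩
      · rcases hb.closed A hA _ h1 _ (hadj j).symm with h | h
        · exact absurd ⟨h, h1⟩ h2
        · exact Or.inr ⟨h, h1⟩
    have htouch : ∀ A ∈ 𝒞, ∀ j ∈ touchingEdges φ A,
        (φ (firstPoint j) ∈ A ∨ φ (secondPoint j) ∈ A) ∧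
        (φ (firstPoint j) ∈ A ∨ φ (firstPoint j) ∈ S) ∧
        (φ (secondPoint j) ∈ A ∨ φ (secondPoint j) ∈ S) := by
      intro A hA j hj
      simp only [touchingEdges, mem_filter, mem_univ, true_and] at hj
      refine ⟨hj, ?_⟩
      rcases hj with h | h
      · exact ⟨Or.inl h, hb.closed A hA _ h _ (hadj j)⟩
      · exact ⟨hb.closed A hA _ h _ (hadj j).symm, Or.inl h⟩
    have htdisj : ∀ A ∈ 𝒞, ∀ B ∈ 𝒞, A ≠ B → Disjoint (touchingEdges φ A) (touchingEdges φ B) := by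
      intro A hA B hB hne
      rw [Finset.disjoint_left]
      intro j hj hj'
      obtain ⟨-, h1, h2⟩ := htouch A hA j hj
      obtain ⟨h3, -, -⟩ := htouch B hB j hj'
      have hAB := Finset.disjoint_left.1 (hb.pair A hA B hB hne)
      have hBS := Finset.disjoint_left.1 (hb.disj B hB)
      rcases h3 with h3 | h3
      · rcases h1 with h | h
        · exact hAB h h3
        · exact hBS h3 h
      · rcases h2 with h | h
        · exact hAB h h3
        · exact hBS h3 h
    -- Boundaries of distinct pieces are disjoint, and each boundary edge uses one of the at most
    -- 4|S| points over S.
    have hbdsum : ∀ 𝒟 ⊆ 𝒞, ∑ A ∈ 𝒟, (bd A).card ≤ 4 * S.card := by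
      intro 𝒟 h𝒟
      have h0 : (𝒟.biUnion bd).card = ∑ A ∈ 𝒟, (bd A).card :=
        card_biUnion (fun A hA B hB hne => (htdisj A (h𝒟 hA) B (h𝒟 hB) hne).mono
          sdiff_subset sdiff_subset)
      rw [← h0]
      have h1 : 𝒟.biUnion bd ⊆ touchingEdges φ S := by
        intro j hj
        obtain ⟨A, hA, hj⟩ := mem_biUnion.1 hj
        simp only [touchingEdges, mem_filter, mem_univ, true_and]
        rcases hbdS A (h𝒟 hA) j hj with h | h
        · exact Or.inr h.2
        · exact Or.inl h.1
      have h2 := card_innerEdges_add_card_touchingEdges hφ S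
      have h3 := hdeg' S
      have h4 := card_le_card h1
      omega
    have hbd4 : ∀ A ∈ 𝒞, (bd A).card ≤ 4 * S.card := by
      intro A hA
      have := hbdsum {A} (by simpa using hA)
      simpa using this
    set 𝒞₁ := 𝒞.filter fun A => ((∑ i ∈ A, d i : ℕ) : ℝ) ≤ α * (2 * ν) with h𝒞₁
    have hlarge : ∀ A ∈ 𝒞, ¬ ((∑ i ∈ A, d i : ℕ) : ℝ) ≤ α * (2 * ν) →
        (1 - α) * (2 * ν) ≤ ((∑ i ∈ A, d i : ℕ) : ℝ) := by
      intro A hA hA'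
      refine (h_conn A ?_).resolve_left hA'
      have h1 : ((bd A).card : ℝ) ≤ 4 * S.card := by exact_mod_cast hbd4 A hA
      have h2 : ((innerEdges φ A).card : ℝ) + (bd A).card = (touchingEdges φ A).card := by
        exact_mod_cast hbdcard A
      linarith
    -- Two exceptional pieces would have degree sums above α·2ν and at least (1 − α)·2ν, hence more
    -- than 2ν together.
    have hcard₁ : S.card + 1 ≤ 𝒞₁.card := by
      have := exists_card_sub_one_filter 𝒞
        (fun A => ((∑ i ∈ A, d i : ℕ) : ℝ) ≤ α * (2 * ν)) (by
          intro A hA B hB hA' hB'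
          by_contra hne
          have h1 := hlarge A hA hA'
          have h2 := hlarge B hB hB'
          have h3 : ∑ i ∈ A, d i + ∑ i ∈ B, d i ≤ 2 * ν := by
            rw [← sum_union (hb.pair A hA B hB hne), ← hsum]
            exact sum_le_sum_of_subset (subset_univ _)
          have h3' : ((∑ i ∈ A, d i : ℕ) : ℝ) + ((∑ i ∈ B, d i : ℕ) : ℝ) ≤ 2 * ν := by
            exact_mod_cast h3
          linarith)
      rw [← h𝒞₁] at this
      have := hb.card
      omega
    obtain ⟨𝒟, h𝒟, h𝒟card⟩ := exists_subset_card_eq hcard₁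
    have h𝒟𝒞 : 𝒟 ⊆ 𝒞 := h𝒟.trans (filter_subset _ _)
    -- With e inner edges, 3|A| ≤ 2e + |bd A|, and sparsity gives e < |A| + max(2, ⌈|A|/25⌉).
    have hsize : ∀ A ∈ 𝒟, A.card ≤ 4 + 5 * (bd A).card := by
      intro A hA
      have h1 : ((∑ i ∈ A, d i : ℕ) : ℝ) ≤ α * (2 * ν) := (mem_filter.1 (h𝒟 hA)).2
      have h2 : (3 * A.card : ℝ) ≤ ((∑ i ∈ A, d i : ℕ) : ℝ) := by exact_mod_cast hdeg A
      have h3 := h_sparse A (card_pos.1 (hb.odd A (h𝒟𝒞 hA)).pos) (by linarith)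
      have h4 := card_innerEdges_add_card_touchingEdges hφ A
      have h5 := hbdcard A
      have h6 := hdeg A
      omega
    -- At least 3|A|/2 edges touch `A`, which suffices for |A| ≥ 3 (after rounding up at 3). A
    -- singleton has no inner edge and touches at least three.
    have htouchcard : ∀ A ∈ 𝒟, A.card + 2 ≤ (touchingEdges φ A).card := by
      intro A hA
      have h4 := card_innerEdges_add_card_touchingEdges hφ A
      have h5 := hbdcard A
      have h6 := hdeg A
      have h7 := hb.odd A (h𝒟𝒞 hA)
      by_cases h1 : A.card = 1
      · obtain ⟨x, rfl⟩ := card_eq_one.1 h1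
        have h8 : innerEdges φ {x} = ∅ := by
          rw [Finset.eq_empty_iff_forall_notMem]
          intro j hj
          simp only [innerEdges, mem_filter, mem_univ, true_and, mem_singleton] at hj
          exact hloop j (hj.1.trans hj.2.symm)
        rw [h8, card_empty] at h4
        omega
      · rw [Nat.odd_iff] at h7
        omega
    set X := S ∪ 𝒟.biUnion id with hX
    have hXcard : X.card = S.card + ∑ A ∈ 𝒟, A.card := by
      have h0 : (𝒟.biUnion id).card = ∑ A ∈ 𝒟, A.card :=
        card_biUnion (fun A hA B hB hne => hb.pair A (h𝒟𝒞 hA) B (h𝒟𝒞 hB) hne)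
      rw [hX, card_union_of_disjoint, h0]
      · rw [disjoint_biUnion_right]
        exact fun A hA => (hb.disj A (h𝒟𝒞 hA)).symm
    have hXin : ∑ A ∈ 𝒟, (touchingEdges φ A).card ≤ (innerEdges φ X).card := by
      rw [← card_biUnion (fun A hA B hB hne => htdisj A (h𝒟𝒞 hA) B (h𝒟𝒞 hB) hne)]
      apply card_le_card
      intro j hj
      obtain ⟨A, hA, hj⟩ := mem_biUnion.1 hj
      obtain ⟨-, h1, h2⟩ := htouch A (h𝒟𝒞 hA) j hj
      have hAX : A ⊆ X := fun x hx => mem_union_right _ (mem_biUnion.2 ⟨A, hA, hx⟩)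
      simp only [innerEdges, mem_filter, mem_univ, true_and]
      exact ⟨h1.elim (fun h => hAX h) (fun h => mem_union_left _ h),
        h2.elim (fun h => hAX h) (fun h => mem_union_left _ h)⟩
    have h1 : ∑ A ∈ 𝒟, A.card + 2 * (S.card + 1) ≤ ∑ A ∈ 𝒟, (touchingEdges φ A).card := by
      have := sum_le_sum htouchcard
      rw [sum_add_distrib, sum_const, h𝒟card, smul_eq_mul] at this
      omega
    have h2 : ∑ A ∈ 𝒟, A.card ≤ 4 * (S.card + 1) + 5 * (4 * S.card) := by
      have := sum_le_sum hsize
      rw [sum_add_distrib, sum_const, h𝒟card, smul_eq_mul, ← mul_sum] at this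
      have := hbdsum 𝒟 h𝒟𝒞
      omega
    -- The origin of 25: |S| + 4(|S| + 1) + 20|S| ≤ 25(|S| + 1). Hence ⌈|X|/25⌉ ≤ |S| + 1, whereas
    -- `X` spans at least |X| + |S| + 2 edges.
    have hXle : X.card ≤ 25 * (S.card + 1) := by omega
    have hXne : X.Nonempty := by
      obtain ⟨A, hA⟩ : 𝒟.Nonempty := card_pos.1 (by omega)
      obtain ⟨x, hx⟩ := card_pos.1 (hb.odd A (h𝒟𝒞 hA)).pos
      exact ⟨x, mem_union_right _ (mem_biUnion.2 ⟨A, hA, hx⟩)⟩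
    have h3 := h_sparse X hXne (by
      have : (X.card : ℝ) ≤ 25 * (S.card + 1) := by exact_mod_cast hXle
      linarith)
    omega

/-! ### Uniform random configurations -/

/-- Two three-colorings of the points with equal class sizes differ by a permutation. Consequently,
the probability that given points lie over given vertices depends only on the number of points. -/
theorem exists_perm_of_card_eq {α : Type*} [Fintype α] [DecidableEq α] {I I' J J' : Finset α}
    (hI : Disjoint I I') (hJ : Disjoint J J') (h : I.card = J.card) (h' : I'.card = J'.card) :
    ∃ σ : Equiv.Perm α, (∀ p, σ p ∈ J ↔ p ∈ I) ∧ ∀ p, σ p ∈ J' ↔ p ∈ I' := by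
  have key : ∀ (I I' : Finset α), Disjoint I I' → ∀ c : Bool × Bool,
      Fintype.card {p // (decide (p ∈ I), decide (p ∈ I')) = c} =
        if c.1 then (if c.2 then 0 else I.card) else
          (if c.2 then I'.card else Fintype.card α - (I.card + I'.card)) := by
    rintro I I' hI ⟨a, b⟩
    rw [Finset.disjoint_left] at hI
    rw [Fintype.card_subtype]
    cases a <;> cases b <;> simp only [Prod.mk.injEq, decide_eq_true_eq, decide_eq_false_iff_not,
      if_true, if_false, Bool.false_eq_true]
    · rw [← card_union_of_disjoint (Finset.disjoint_left.2 hI), ← card_compl]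
      congr 1
      ext p
      simp
    · congr 1
      ext p
      have := @hI p
      simp only [mem_filter, mem_univ, true_and]
      tauto
    · congr 1
      ext p
      have := @hI p
      simp only [mem_filter, mem_univ, true_and]
      tauto
    · rw [card_eq_zero, filter_eq_empty_iff]
      intro p _ hp
      exact hI hp.1 hp.2
  have e : ∀ c : Bool × Bool, Nonempty ({p // (decide (p ∈ I), decide (p ∈ I')) = c} ≃
      {p // (decide (p ∈ J), decide (p ∈ J')) = c}) := by
    intro c
    rw [← Fintype.card_eq, key I I' hI, key J J' hJ, h, h']
  replace e := fun c => (e c).some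
  refine ⟨Equiv.ofFiberEquiv e, fun p => ?_, fun p => ?_⟩
  · have := Equiv.ofFiberEquiv_map e p
    simp only [Prod.mk.injEq, decide_eq_decide] at this
    exact this.1
  · have := Equiv.ofFiberEquiv_map e p
    simp only [Prod.mk.injEq, decide_eq_decide] at this
    exact this.2

open Classical in
/-- The finite set of configurations. -/
noncomputable def cfg {n : ℕ} (d : Fin n → ℕ) (ν : ℕ) : Finset (Fin (2 * ν) → Fin n) :=
  univ.filter fun φ => φ ∈ configurations d ν

theorem mem_cfg {n ν : ℕ} {d : Fin n → ℕ} {φ : Fin (2 * ν) → Fin n} :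
    φ ∈ cfg d ν ↔ φ ∈ configurations d ν := by
  simp [cfg]

theorem comp_perm_mem_cfg {n ν : ℕ} {d : Fin n → ℕ} {φ : Fin (2 * ν) → Fin n}
    (σ : Equiv.Perm (Fin (2 * ν))) (hφ : φ ∈ cfg d ν) : φ ∘ σ ∈ cfg d ν := by
  rw [mem_cfg] at hφ ⊢
  intro i
  rw [← hφ i]
  refine card_bij (fun w _ => σ w) ?_ ?_ ?_
  · intro w hw
    simpa using hw
  · intro a _ b _ h
    exact σ.injective h
  · intro w hw
    exact ⟨σ.symm w, by simpa using hw, by simp⟩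

theorem cfg_nonempty {n ν : ℕ} {d : Fin n → ℕ} (hsum : ∑ i, d i = 2 * ν) : (cfg d ν).Nonempty := by
  have e : Nonempty (Fin (2 * ν) ≃ Σ i, Fin (d i)) := by
    rw [← Fintype.card_eq]
    simp [hsum]
  obtain ⟨e⟩ := e
  refine ⟨fun w => (e w).1, mem_cfg.2 fun i => ?_⟩
  have h : (univ.filter fun w => (e w).1 = i).card = (univ : Finset (Fin (d i))).card := by
    symm
    refine card_bij (fun a _ => e.symm ⟨i, a⟩) ?_ ?_ ?_
    · intro a _
      simp
    · intro a _ b _ h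
      simpa using h
    · intro w hw
      simp only [mem_filter, mem_univ, true_and] at hw
      subst hw
      exact ⟨(e w).2, mem_univ _, by simp⟩
  rw [h, card_univ, Fintype.card_fin]

open Classical in
/-- The probability of an event under a uniformly random configuration. -/
noncomputable def confProb {n : ℕ} (d : Fin n → ℕ) (ν : ℕ)
    (E : (Fin (2 * ν) → Fin n) → Prop) : ℝ :=
  ((cfg d ν).filter E).card / (cfg d ν).card

theorem confProb_nonneg {n ν : ℕ} {d : Fin n → ℕ} (E : (Fin (2 * ν) → Fin n) → Prop) :
    0 ≤ confProb d ν E := by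
  unfold confProb; positivity

theorem confProb_mono {n ν : ℕ} {d : Fin n → ℕ} {E F : (Fin (2 * ν) → Fin n) → Prop}
    (h : ∀ φ ∈ configurations d ν, E φ → F φ) : confProb d ν E ≤ confProb d ν F := by
  classical
  unfold confProb
  gcongr ?_ / _
  norm_cast
  apply card_le_card
  intro φ hφ
  rw [mem_filter] at hφ ⊢
  exact ⟨hφ.1, h φ (mem_cfg.1 hφ.1) hφ.2⟩

theorem confProb_exists_le {n ν : ℕ} {d : Fin n → ℕ} {ι : Type*} (s : Finset ι)
    (E : ι → (Fin (2 * ν) → Fin n) → Prop) :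
    confProb d ν (fun φ => ∃ a ∈ s, E a φ) ≤ ∑ a ∈ s, confProb d ν (E a) := by
  classical
  unfold confProb
  rw [← sum_div]
  gcongr ?_ / _
  norm_cast
  refine (card_le_card (t := s.biUnion fun a => (cfg d ν).filter (E a)) ?_).trans card_biUnion_le
  intro φ hφ
  obtain ⟨hφ, a, ha, h⟩ := (@mem_filter _ _ (_) _ _).1 hφ
  exact mem_biUnion.2 ⟨a, ha, mem_filter.2 ⟨hφ, h⟩⟩

theorem confProb_or_le {n ν : ℕ} {d : Fin n → ℕ} (E F : (Fin (2 * ν) → Fin n) → Prop) :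
    confProb d ν (fun φ => E φ ∨ F φ) ≤ confProb d ν E + confProb d ν F := by
  classical
  unfold confProb
  rw [← add_div]
  gcongr ?_ / _
  norm_cast
  refine (card_le_card (t := (cfg d ν).filter E ∪ (cfg d ν).filter F) ?_).trans (card_union_le _ _)
  intro φ hφ
  rw [mem_union, mem_filter, mem_filter]
  obtain ⟨h1, h2⟩ := (@mem_filter _ _ (_) _ _).1 hφ
  exact h2.imp (fun h => ⟨h1, h⟩) fun h => ⟨h1, h⟩

-- Markov's inequality for the number of events that occur, with the division by `r` cleared.
open Classical in
theorem confProb_card_ge_mul_le {n ν : ℕ} {d : Fin n → ℕ} {ι : Type*} (s : Finset ι)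
    (E : ι → (Fin (2 * ν) → Fin n) → Prop) (r : ℝ) :
    confProb d ν (fun φ => r ≤ (s.filter fun a => E a φ).card) * r ≤
      ∑ a ∈ s, confProb d ν (E a) := by
  unfold confProb
  rw [← sum_div, div_mul_eq_mul_div]
  gcongr ?_ / _
  have h1 : ∑ a ∈ s, (((cfg d ν).filter (E a)).card : ℝ) =
      ∑ φ ∈ cfg d ν, ((s.filter fun a => E a φ).card : ℝ) := by
    simp_rw [card_filter]
    push_cast
    exact sum_comm
  rw [h1]
  calc _ = ∑ φ ∈ (cfg d ν).filter (fun φ => r ≤ (s.filter fun a => E a φ).card), r := by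
        rw [sum_const, nsmul_eq_mul]
    _ ≤ ∑ φ ∈ (cfg d ν).filter (fun φ => r ≤ (s.filter fun a => E a φ).card),
        ((s.filter fun a => E a φ).card : ℝ) :=
        sum_le_sum fun φ hφ => (mem_filter.1 hφ).2
    _ ≤ _ := sum_le_sum_of_subset_of_nonneg (filter_subset _ _) fun _ _ _ => by positivity

/-- The probability that two given disjoint sets of points lie over two given disjoint sets of
vertices. -/
theorem confProb_over_mul {n ν : ℕ} {d : Fin n → ℕ} (hsum : ∑ i, d i = 2 * ν)
    {I I' : Finset (Fin (2 * ν))} (hI : Disjoint I I') {T S : Finset (Fin n)}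
    (hTS : Disjoint T S) :
    confProb d ν (fun φ => (∀ p ∈ I, φ p ∈ T) ∧ ∀ p ∈ I', φ p ∈ S) *
      ((2 * ν).choose I.card * (2 * ν - I.card).choose I'.card : ℕ) =
      ((∑ i ∈ T, d i).choose I.card * (∑ i ∈ S, d i).choose I'.card : ℕ) := by
  classical
  set k := I.card with hk
  set l := I'.card with hl
  set P : Finset (Finset (Fin (2 * ν)) × Finset (Fin (2 * ν))) :=
    univ.filter fun p => Disjoint p.1 p.2 ∧ p.1.card = k ∧ p.2.card = l with hP
  have hPcard : P.card = (2 * ν).choose k * (2 * ν - k).choose l := by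
    rw [card_eq_sum_card_fiberwise (f := Prod.fst) (t := powersetCard k univ)]
    · rw [sum_const_nat (m := (2 * ν - k).choose l)]
      · simp
      · intro J hJ
        rw [mem_powersetCard] at hJ
        have h1 : (powersetCard l Jᶜ).card = (2 * ν - k).choose l := by
          rw [card_powersetCard, card_compl, hJ.2, Fintype.card_fin]
        rw [← h1]
        refine card_bij (fun p _ => p.2) ?_ ?_ ?_
        · rintro ⟨a, b⟩ hp
          simp only [hP, mem_filter, mem_univ, true_and] at hp
          obtain ⟨⟨hab, -, h3⟩, rfl⟩ := hp
          rw [mem_powersetCard]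
          exact ⟨subset_compl_iff_disjoint_left.2 hab, h3⟩
        · rintro ⟨a, b⟩ hp ⟨a', b'⟩ hp' h
          simp only [mem_filter] at hp hp'
          obtain ⟨-, rfl⟩ := hp
          obtain ⟨-, rfl⟩ := hp'
          simp only at h
          rw [h]
        · intro b hb
          rw [mem_powersetCard] at hb
          refine ⟨(J, b), ?_, rfl⟩
          simp only [hP, mem_filter, mem_univ, true_and, and_true]
          exact ⟨subset_compl_iff_disjoint_left.1 hb.1, hJ.2, hb.2⟩
    · intro p hp
      simp only [hP, mem_coe, mem_filter, mem_univ, true_and] at hp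
      simp [hp.2.1]
  -- By symmetry every pair in `P` has the same count of configurations, while a fixed configuration
  -- is good for a number of pairs that does not depend on it. Double counting then gives the
  -- probability.
  have hsymm : ∀ p ∈ P, ((cfg d ν).filter fun φ => (∀ w ∈ p.1, φ w ∈ T) ∧ ∀ w ∈ p.2, φ w ∈ S).card
      = ((cfg d ν).filter fun φ => (∀ w ∈ I, φ w ∈ T) ∧ ∀ w ∈ I', φ w ∈ S).card := by
    rintro ⟨J, J'⟩ hp
    simp only [hP, mem_filter, mem_univ, true_and] at hp
    obtain ⟨σ, h1, h2⟩ := exists_perm_of_card_eq hI hp.1 hp.2.1.symm hp.2.2.symm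
    refine card_bij (fun φ _ => φ ∘ σ) ?_ ?_ ?_
    · intro φ hφ
      simp only [mem_filter] at hφ ⊢
      exact ⟨comp_perm_mem_cfg σ hφ.1, fun w hw => hφ.2.1 _ ((h1 w).2 hw),
        fun w hw => hφ.2.2 _ ((h2 w).2 hw)⟩
    · intro φ _ φ' _ h
      funext w
      have := congrFun h (σ.symm w)
      simpa using this
    · intro φ hφ
      simp only [mem_filter] at hφ
      refine ⟨φ ∘ σ.symm, ?_, by funext w; simp⟩
      simp only [mem_filter]
      refine ⟨comp_perm_mem_cfg σ.symm hφ.1, fun w hw => hφ.2.1 _ ?_, fun w hw => hφ.2.2 _ ?_⟩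
      · rw [← h1]; simpa using hw
      · rw [← h2]; simpa using hw
  have hcount : ∀ φ ∈ cfg d ν, (P.filter fun p => (∀ w ∈ p.1, φ w ∈ T) ∧ ∀ w ∈ p.2, φ w ∈ S).card
      = (∑ i ∈ T, d i).choose k * (∑ i ∈ S, d i).choose l := by
    intro φ hφ
    rw [mem_cfg] at hφ
    rw [← card_points_over hφ T, ← card_points_over hφ S, ← card_powersetCard, ← card_powersetCard,
      ← card_product]
    congr 1
    ext ⟨a, b⟩
    simp only [hP, mem_filter, mem_univ, true_and, mem_product, mem_powersetCard, subset_iff]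
    constructor
    · rintro ⟨⟨-, h1, h2⟩, h3, h4⟩
      exact ⟨⟨h3, h1⟩, h4, h2⟩
    · rintro ⟨⟨h3, h1⟩, h4, h2⟩
      refine ⟨⟨?_, h1, h2⟩, h3, h4⟩
      rw [Finset.disjoint_left]
      intro w hw hw'
      exact Finset.disjoint_left.1 hTS (h3 w hw) (h4 w hw')
  have hdouble : ∑ p ∈ P, ((cfg d ν).filter fun φ =>
      (∀ w ∈ p.1, φ w ∈ T) ∧ ∀ w ∈ p.2, φ w ∈ S).card =
      ∑ φ ∈ cfg d ν, (P.filter fun p => (∀ w ∈ p.1, φ w ∈ T) ∧ ∀ w ∈ p.2, φ w ∈ S).card := by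
    simp_rw [card_filter]
    exact sum_comm
  rw [sum_congr rfl hsymm, sum_congr rfl hcount, sum_const, sum_const, smul_eq_mul, smul_eq_mul,
    hPcard] at hdouble
  have hpos : (0 : ℝ) < (cfg d ν).card := by
    exact_mod_cast card_pos.2 (cfg_nonempty hsum)
  unfold confProb
  rw [div_mul_eq_mul_div, div_eq_iff hpos.ne']
  have hd' : (((2 * ν).choose k * (2 * ν - k).choose l *
    ((cfg d ν).filter fun φ => (∀ w ∈ I, φ w ∈ T) ∧ ∀ w ∈ I', φ w ∈ S).card : ℕ) : ℝ) =
    (((cfg d ν).card * ((∑ i ∈ T, d i).choose k * (∑ i ∈ S, d i).choose l) : ℕ) : ℝ) := by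
    exact_mod_cast hdouble
  push_cast at hd' ⊢
  rw [mul_comm (_ * _ : ℝ) (Finset.card (cfg d ν) : ℝ), ← hd', mul_comm]
  congr!

/-- A single term of Vandermonde's identity. It simplifies the union bound over sets of edges at
little cost. -/
theorem sq_choose_le_choose_two_mul (ν i : ℕ) : ν.choose i ^ 2 ≤ (2 * ν).choose (2 * i) := by
  rw [two_mul, two_mul, Nat.add_choose_eq, sq]
  exact single_le_sum (f := fun ij : ℕ × ℕ => ν.choose ij.1 * ν.choose ij.2)
    (fun _ _ => Nat.zero_le _) (mem_antidiagonal.2 rfl : (i, i) ∈ antidiagonal (i + i))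

theorem firstPoint_injective {ν : ℕ} : Function.Injective (firstPoint (ν := ν)) := by
  intro a b h
  simp only [firstPoint, Fin.mk.injEq] at h
  ext; omega

theorem secondPoint_injective {ν : ℕ} : Function.Injective (secondPoint (ν := ν)) := by
  intro a b h
  simp only [secondPoint, Fin.mk.injEq] at h
  ext; omega

theorem firstPoint_ne_secondPoint {ν : ℕ} (a b : Fin ν) : firstPoint a ≠ secondPoint b := by
  intro h
  simp only [firstPoint, secondPoint, Fin.mk.injEq] at h
  omega

theorem disjoint_image_firstPoint_image_secondPoint {ν : ℕ} (J J' : Finset (Fin ν)) :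
    Disjoint (J.image firstPoint) (J'.image secondPoint) := by
  rw [Finset.disjoint_left]
  intro w hw hw'
  obtain ⟨a, -, rfl⟩ := mem_image.1 hw
  obtain ⟨b, -, h⟩ := mem_image.1 hw'
  exact firstPoint_ne_secondPoint a b h.symm

theorem card_image_firstPoint_union_image_secondPoint {ν : ℕ} (J J' : Finset (Fin ν)) :
    (J.image firstPoint ∪ J'.image secondPoint).card = J.card + J'.card := by
  rw [card_union_of_disjoint (disjoint_image_firstPoint_image_secondPoint J J'),
    card_image_of_injective _ firstPoint_injective, card_image_of_injective _ secondPoint_injective]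

/-- The probability that a vertex set spans many edges. -/
theorem confProb_le_card_innerEdges_mul {n ν : ℕ} {d : Fin n → ℕ} (hsum : ∑ i, d i = 2 * ν)
    (A : Finset (Fin n)) (i : ℕ) :
    confProb d ν (fun φ => i ≤ (innerEdges φ A).card) * ν.choose i ≤
      (∑ v ∈ A, d v).choose (2 * i) := by
  classical
  rcases lt_or_ge ν i with hi | hi
  · rw [Nat.choose_eq_zero_of_lt hi]
    simp
  have hpos : (0 : ℝ) < (2 * ν).choose (2 * i) := by
    exact_mod_cast Nat.choose_pos (by omega)
  have hJ : ∀ J ∈ powersetCard i (univ : Finset (Fin ν)),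
      confProb d ν (fun φ => ∀ p ∈ J.image firstPoint ∪ J.image secondPoint, φ p ∈ A) =
        ((∑ v ∈ A, d v).choose (2 * i) : ℝ) / (2 * ν).choose (2 * i) := by
    intro J hJ
    rw [mem_powersetCard] at hJ
    have h := confProb_over_mul hsum (I := J.image firstPoint ∪ J.image secondPoint) (I' := ∅)
      (disjoint_empty_right _) (T := A) (S := ∅) (disjoint_empty_right _)
    rw [card_image_firstPoint_union_image_secondPoint, hJ.2, ← two_mul] at h
    simp only [notMem_empty, false_imp_iff, implies_true, and_true, card_empty, Nat.choose_zero_right,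
      mul_one] at h
    rw [eq_div_iff hpos.ne']
    exact h
  have h1 : confProb d ν (fun φ => i ≤ (innerEdges φ A).card) ≤
      ν.choose i * (((∑ v ∈ A, d v).choose (2 * i) : ℝ) / (2 * ν).choose (2 * i)) := by
    calc _ ≤ confProb d ν (fun φ => ∃ J ∈ powersetCard i (univ : Finset (Fin ν)),
            ∀ p ∈ J.image firstPoint ∪ J.image secondPoint, φ p ∈ A) := by
          refine confProb_mono fun φ _ h => ?_
          obtain ⟨J, hJ, hJi⟩ := exists_subset_card_eq h
          refine ⟨J, mem_powersetCard.2 ⟨subset_univ _, hJi⟩, fun p hp => ?_⟩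
          rcases mem_union.1 hp with hp | hp <;> obtain ⟨j, hj, rfl⟩ := mem_image.1 hp
          · exact (mem_filter.1 (hJ hj)).2.1
          · exact (mem_filter.1 (hJ hj)).2.2
      _ ≤ _ := confProb_exists_le _ _
      _ = _ := by
          rw [sum_congr rfl hJ, sum_const, card_powersetCard, card_univ, Fintype.card_fin,
            nsmul_eq_mul]
  have h2 : ((ν.choose i : ℝ)) ^ 2 ≤ (2 * ν).choose (2 * i) := by
    exact_mod_cast sq_choose_le_choose_two_mul ν i
  have h3 : (0 : ℝ) ≤ ν.choose i := by positivity
  calc _ ≤ ν.choose i * (((∑ v ∈ A, d v).choose (2 * i) : ℝ) / (2 * ν).choose (2 * i)) *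
        ν.choose i := by gcongr
    _ = (ν.choose i : ℝ) ^ 2 * (((∑ v ∈ A, d v).choose (2 * i) : ℝ) / (2 * ν).choose (2 * i)) := by
        ring
    _ ≤ (2 * ν).choose (2 * i) *
        (((∑ v ∈ A, d v).choose (2 * i) : ℝ) / (2 * ν).choose (2 * i)) := by gcongr
    _ = _ := by field_simp

theorem EdgesGoTo.card_touchingEdges {n ν : ℕ} {d : Fin n → ℕ} {φ : Fin (2 * ν) → Fin n}
    (hφ : φ ∈ configurations d ν) {T S : Finset (Fin n)} (hTS : Disjoint T S)
    (h : EdgesGoTo φ T S) : (touchingEdges φ T).card = ∑ i ∈ T, d i := by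
  rw [← card_innerEdges_add_card_touchingEdges hφ T]
  have : innerEdges φ T = ∅ := by
    rw [Finset.eq_empty_iff_forall_notMem]
    intro j hj
    simp only [innerEdges, mem_filter, mem_univ, true_and] at hj
    exact Finset.disjoint_left.1 hTS hj.2 ((h j).1 hj.1)
  rw [this, card_empty, zero_add]

/-- The probability that all edges of `T` go to `S`. -/
theorem confProb_edgesGoTo_mul {n ν : ℕ} {d : Fin n → ℕ} (hsum : ∑ i, d i = 2 * ν)
    {T S : Finset (Fin n)} (hTS : Disjoint T S) (hb : ∑ i ∈ T, d i ≤ ν) :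
    confProb d ν (fun φ => EdgesGoTo φ T S) * (ν.choose (∑ i ∈ T, d i) * 2 ^ (∑ i ∈ T, d i)) ≤
      (2 * (∑ i ∈ T, d i : ℕ) + 1) * (∑ i ∈ S, d i).choose (∑ i ∈ T, d i) := by
  classical
  set b := ∑ i ∈ T, d i with hbdef
  set a := ∑ i ∈ S, d i with hadef
  have hchoose : (2 * ν).choose b * (2 * ν - b).choose b = (2 * ν).choose (2 * b) * b.centralBinom := by
    have := Nat.choose_mul (n := 2 * ν) (k := 2 * b) (s := b) (by omega)
    rw [Nat.centralBinom_eq_two_mul_choose, this]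
    congr 2
    omega
  have hpos : (0 : ℝ) < (2 * ν).choose (2 * b) * b.centralBinom := by
    have := Nat.choose_pos (n := 2 * ν) (k := 2 * b) (by omega)
    have := Nat.centralBinom_pos b
    positivity
  -- A pattern for the union bound: the set J of edges touching `T`, with the subset of those whose
  -- second point lies over `T`.
  set s : Finset (Σ _ : Finset (Fin ν), Finset (Fin ν)) :=
    (powersetCard b (univ : Finset (Fin ν))).sigma fun J => J.powerset with hs
  have hJ : ∀ x ∈ s, confProb d ν (fun φ =>
      (∀ p ∈ (x.1 \ x.2).image firstPoint ∪ x.2.image secondPoint, φ p ∈ T) ∧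
      ∀ p ∈ x.2.image firstPoint ∪ (x.1 \ x.2).image secondPoint, φ p ∈ S) =
        (a.choose b : ℝ) / ((2 * ν).choose (2 * b) * b.centralBinom) := by
    rintro ⟨J, J'⟩ hx
    simp only [hs, mem_sigma, mem_powersetCard, mem_powerset] at hx
    obtain ⟨⟨-, hJ⟩, hJ'⟩ := hx
    have hc := card_sdiff_add_card_eq_card hJ'
    have hdisj : Disjoint ((J \ J').image firstPoint ∪ J'.image secondPoint)
        (J'.image firstPoint ∪ (J \ J').image secondPoint) := by
      rw [disjoint_union_left, disjoint_union_right, disjoint_union_right]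
      refine ⟨⟨?_, disjoint_image_firstPoint_image_secondPoint _ _⟩,
        (disjoint_image_firstPoint_image_secondPoint _ _).symm, ?_⟩
      · exact (disjoint_image firstPoint_injective).2 sdiff_disjoint
      · exact (disjoint_image secondPoint_injective).2 disjoint_sdiff
    have h := confProb_over_mul hsum hdisj hTS
    rw [card_image_firstPoint_union_image_secondPoint, card_image_firstPoint_union_image_secondPoint,
      hc, hJ, add_comm, hc, hJ, ← hbdef, ← hadef, hchoose, Nat.choose_self, one_mul] at h
    rw [eq_div_iff hpos.ne']
    exact_mod_cast h
  have hscard : s.card = ν.choose b * 2 ^ b := by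
    rw [hs, card_sigma, sum_const_nat (m := 2 ^ b)]
    · simp
    · intro J hJ
      rw [card_powerset, (mem_powersetCard.1 hJ).2]
  have h1 : confProb d ν (fun φ => EdgesGoTo φ T S) ≤
      (ν.choose b * 2 ^ b) * ((a.choose b : ℝ) / ((2 * ν).choose (2 * b) * b.centralBinom)) := by
    calc _ ≤ confProb d ν (fun φ => ∃ x ∈ s,
          (∀ p ∈ (x.1 \ x.2).image firstPoint ∪ x.2.image secondPoint, φ p ∈ T) ∧
          ∀ p ∈ x.2.image firstPoint ∪ (x.1 \ x.2).image secondPoint, φ p ∈ S) := by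
          refine confProb_mono fun φ hφ h => ?_
          refine ⟨⟨touchingEdges φ T, (touchingEdges φ T).filter fun j => φ (secondPoint j) ∈ T⟩,
            ?_, ?_, ?_⟩
          · simp only [hs, mem_sigma, mem_powersetCard, mem_powerset]
            exact ⟨⟨subset_univ _, h.card_touchingEdges hφ hTS⟩, filter_subset _ _⟩
          · intro p hp
            rcases mem_union.1 hp with hp | hp <;> obtain ⟨j, hj, rfl⟩ := mem_image.1 hp
            · simp only [touchingEdges, mem_sdiff, mem_filter, mem_univ, true_and] at hj
              tauto
            · exact (mem_filter.1 hj).2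
          · intro p hp
            rcases mem_union.1 hp with hp | hp <;> obtain ⟨j, hj, rfl⟩ := mem_image.1 hp
            · exact (h j).2 (mem_filter.1 hj).2
            · simp only [touchingEdges, mem_sdiff, mem_filter, mem_univ, true_and] at hj
              exact (h j).1 (by tauto)
      _ ≤ _ := confProb_exists_le _ _
      _ = _ := by
          rw [sum_congr rfl hJ, sum_const, hscard, nsmul_eq_mul]
          push_cast
          ring
  have h2 : ((ν.choose b : ℝ)) ^ 2 ≤ (2 * ν).choose (2 * b) := by
    exact_mod_cast sq_choose_le_choose_two_mul ν b
  have h3 : (4 : ℝ) ^ b ≤ (2 * b + 1) * b.centralBinom := by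
    exact_mod_cast Nat.four_pow_le_two_mul_add_one_mul_central_binom b
  calc _ ≤ (ν.choose b * 2 ^ b) * ((a.choose b : ℝ) / ((2 * ν).choose (2 * b) * b.centralBinom)) *
        (ν.choose b * 2 ^ b) := by gcongr
    _ = (ν.choose b : ℝ) ^ 2 * 4 ^ b *
        ((a.choose b : ℝ) / ((2 * ν).choose (2 * b) * b.centralBinom)) := by
        rw [show (4 : ℝ) = 2 * 2 by norm_num, mul_pow]; ring
    _ ≤ (2 * ν).choose (2 * b) * ((2 * b + 1) * b.centralBinom) *
        ((a.choose b : ℝ) / ((2 * ν).choose (2 * b) * b.centralBinom)) := by gcongr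
    _ = _ := by
        have h4 : ((2 * ν).choose (2 * b) : ℝ) ≠ 0 := left_ne_zero_of_mul hpos.ne'
        have h5 : (b.centralBinom : ℝ) ≠ 0 := right_ne_zero_of_mul hpos.ne'
        field_simp

/-- The largest term of the binomial distribution with mean `b` is at least `1 / (ν + 1)`. -/
theorem one_le_succ_mul_choose_mul {ν b : ℕ} (hb : b ≤ ν) (hν : 0 < ν) :
    1 ≤ (ν + 1 : ℝ) * (ν.choose b * ((b / ν : ℝ) ^ b * (1 - b / ν : ℝ) ^ (ν - b))) := by
  have hν' : (0 : ℝ) < ν := by exact_mod_cast hν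
  set θ : ℝ := b / ν with hθ
  have hθ0 : 0 ≤ θ := by positivity
  have hb' : (b : ℝ) ≤ ν := by exact_mod_cast hb
  have hθ1 : θ ≤ 1 := by rw [hθ, div_le_one hν']; exact hb'
  -- The case b = ν is separate because the ratio of consecutive terms has 1 − θ in its denominator.
  -- Otherwise the terms increase up to b and decrease afterwards, and ν + 1 terms sum to 1.
  rcases hb.eq_or_lt with rfl | hlt
  · have : θ = 1 := by rw [hθ]; field_simp
    rw [this]
    simp
  have hθ1' : θ < 1 := by rw [hθ, div_lt_one hν']; exact_mod_cast hlt
  set t : ℕ → ℝ := fun k => ν.choose k * (θ ^ k * (1 - θ) ^ (ν - k)) with ht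
  have ht0 : ∀ k, 0 ≤ t k := fun k => by
    have := sub_nonneg.2 hθ1
    positivity
  have hratio : ∀ k < ν, t (k + 1) * ((k + 1) * (1 - θ)) = t k * ((ν - k) * θ) := by
    intro k hk
    have h1 : (ν.choose (k + 1) : ℝ) * (k + 1) = ν.choose k * (ν - k) := by
      have := Nat.choose_succ_right_eq ν k
      rw [← Nat.cast_sub hk.le]
      exact_mod_cast this
    have h2 : ν - k = (ν - (k + 1)) + 1 := by omega
    simp only [ht]
    rw [h2, pow_succ, pow_succ]
    linear_combination (θ ^ k * θ * (1 - θ) ^ (ν - (k + 1)) * (1 - θ)) * h1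
  have hθν : θ * ν = b := by rw [hθ]; field_simp
  have hup : ∀ k < b, t k ≤ t (k + 1) := by
    intro k hk
    have hk' : (k : ℝ) + 1 ≤ b := by exact_mod_cast hk
    have h1 : ((k : ℝ) + 1) * (1 - θ) ≤ (ν - k) * θ := by nlinarith
    have h2 : 0 < ((k : ℝ) + 1) * (1 - θ) := mul_pos (by positivity) (sub_pos.2 hθ1')
    have h3 := hratio k (by omega)
    refine le_of_mul_le_mul_right ?_ h2
    rw [h3]
    exact mul_le_mul_of_nonneg_left h1 (ht0 k)
  have hdown : ∀ k, b ≤ k → k < ν → t (k + 1) ≤ t k := by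
    intro k hk hkν
    have hk' : (b : ℝ) ≤ k := by exact_mod_cast hk
    have h1 : (ν - k) * θ ≤ ((k : ℝ) + 1) * (1 - θ) := by nlinarith
    have h2 : 0 < ((k : ℝ) + 1) * (1 - θ) := mul_pos (by positivity) (sub_pos.2 hθ1')
    have h3 := hratio k hkν
    refine le_of_mul_le_mul_right ?_ h2
    rw [h3]
    exact mul_le_mul_of_nonneg_left h1 (ht0 k)
  have hmax : ∀ k ∈ range (ν + 1), t k ≤ t b := by
    intro k hk
    rw [mem_range] at hk
    rcases le_total k b with hkb | hkb
    · have : ∀ j ≤ b, t (b - j) ≤ t b := by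
        intro j
        induction j with
        | zero => intro _; exact le_rfl
        | succ j ih =>
          intro hj
          refine (hup (b - (j + 1)) (by omega)).trans ?_
          have h : b - (j + 1) + 1 = b - j := by omega
          rw [h]
          exact ih (by omega)
      have h := this (b - k) (by omega)
      rwa [Nat.sub_sub_self hkb] at h
    · have : ∀ k, b ≤ k → k ≤ ν → t k ≤ t b := by
        intro k hk
        induction k, hk using Nat.le_induction with
        | base => intro _; exact le_rfl
        | succ k hk ih => intro h; exact (hdown k hk (by omega)).trans (ih (by omega))
      exact this k hkb (by omega)
  have hsum1 : ∑ k ∈ range (ν + 1), t k = 1 := by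
    have := add_pow θ (1 - θ) ν
    rw [add_sub_cancel, one_pow] at this
    rw [this]
    refine sum_congr rfl fun k _ => ?_
    simp only [ht]
    ring
  have := sum_le_card_nsmul _ _ _ hmax
  rw [hsum1, card_range, nsmul_eq_mul] at this
  exact_mod_cast this

/-! ### First moments for small vertex sets -/

theorem card_le_of_degree {n ν : ℕ} {d : Fin n → ℕ} (hd : ∀ i, 3 ≤ d i ∧ d i ≤ 4)
    (hsum : ∑ i, d i = 2 * ν) : 3 * n ≤ 2 * ν ∧ ν ≤ 2 * n := by
  have h1 := Finset.card_nsmul_le_sum univ d 3 fun i _ => (hd i).1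
  have h2 := Finset.sum_le_card_nsmul univ d 4 fun i _ => (hd i).2
  rw [card_univ, Fintype.card_fin, smul_eq_mul, hsum] at h1 h2
  omega

/-- A crude bound for small sets: C(D, 2m) ≤ 2^D with D ≤ 4|A|, and n ≤ ν. -/
theorem confProb_le_card_innerEdges_le {n ν : ℕ} {d : Fin n → ℕ} (hd : ∀ i, 3 ≤ d i ∧ d i ≤ 4)
    (hsum : ∑ i, d i = 2 * ν) (A : Finset (Fin n)) {m : ℕ} (hm : m ≤ n) :
    confProb d ν (fun φ => m ≤ (innerEdges φ A).card) ≤ 16 ^ A.card / n.choose m := by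
  have hν := card_le_of_degree hd hsum
  have h1 := confProb_le_card_innerEdges_mul hsum A m
  have h2 : (∑ v ∈ A, d v).choose (2 * m) ≤ 16 ^ A.card := by
    calc _ ≤ 2 ^ (∑ v ∈ A, d v) := Nat.choose_le_two_pow _ _
      _ ≤ 2 ^ (4 * A.card) := by
        apply Nat.pow_le_pow_right (by norm_num)
        have := Finset.sum_le_card_nsmul A d 4 fun i _ => (hd i).2
        rwa [smul_eq_mul, mul_comm] at this
      _ = 16 ^ A.card := by rw [pow_mul]; norm_num
  have h3 : n.choose m ≤ ν.choose m := Nat.choose_le_choose m (by omega)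
  have h4 : 0 < n.choose m := Nat.choose_pos hm
  have h2' : ((∑ v ∈ A, d v).choose (2 * m) : ℝ) ≤ 16 ^ A.card := by exact_mod_cast h2
  have h3' : (n.choose m : ℝ) ≤ ν.choose m := by exact_mod_cast h3
  have h4' : (0 : ℝ) < n.choose m := by exact_mod_cast h4
  rw [le_div_iff₀ h4']
  have := mul_le_mul_of_nonneg_left h3' (confProb_nonneg (d := d) (ν := ν)
    (fun φ => m ≤ (innerEdges φ A).card))
  linarith

theorem sum_filter_card {n : ℕ} (p : ℕ → Prop) [DecidablePred p] (g : ℕ → ℝ) :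
    ∑ A ∈ univ.filter (fun A : Finset (Fin n) => p A.card), g A.card =
      ∑ k ∈ (range (n + 1)).filter p, n.choose k * g k := by
  have h := sum_powerset_apply_card (fun k => if p k then g k else 0)
    (x := (univ : Finset (Fin n)))
  rw [powerset_univ] at h
  rw [sum_filter, h, sum_filter, card_univ, Fintype.card_fin]
  refine sum_congr rfl fun k _ => ?_
  split_ifs <;> simp

/-- There are few small sets spanning at least as many edges as vertices. -/
theorem confProb_card_cyclic_mul_le {n ν : ℕ} {d : Fin n → ℕ} (hd : ∀ i, 3 ≤ d i ∧ d i ≤ 4)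
    (hsum : ∑ i, d i = 2 * ν) (K : ℕ) (r : ℝ) :
    confProb d ν (fun φ => r ≤ ((univ.filter fun A : Finset (Fin n) =>
      2 ≤ A.card ∧ A.card ≤ K ∧ A.card ≤ (innerEdges φ A).card).card : ℝ)) * r ≤
      ∑ k ∈ range (K + 1), (16 : ℝ) ^ k := by
  classical
  have h1 := confProb_card_ge_mul_le (d := d) (ν := ν)
    (univ.filter fun A : Finset (Fin n) => 2 ≤ A.card ∧ A.card ≤ K)
    (fun A φ => A.card ≤ (innerEdges φ A).card) r
  have h2 : ∑ A ∈ univ.filter (fun A : Finset (Fin n) => 2 ≤ A.card ∧ A.card ≤ K),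
      confProb d ν (fun φ => A.card ≤ (innerEdges φ A).card) ≤
      ∑ A ∈ univ.filter (fun A : Finset (Fin n) => 2 ≤ A.card ∧ A.card ≤ K),
        (16 : ℝ) ^ A.card / n.choose A.card := by
    refine sum_le_sum fun A _ => confProb_le_card_innerEdges_le hd hsum A ?_
    exact (card_le_univ A).trans (by simp)
  rw [sum_filter_card (fun k => 2 ≤ k ∧ k ≤ K) (fun k => (16 : ℝ) ^ k / n.choose k)] at h2
  -- The binomial coefficients cancel, so the expected number of such k-sets is at most 16^k,
  -- independently of n.
  have h3 : ∑ k ∈ (range (n + 1)).filter (fun k => 2 ≤ k ∧ k ≤ K),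
      (n.choose k : ℝ) * (16 ^ k / n.choose k) ≤ ∑ k ∈ range (K + 1), (16 : ℝ) ^ k := by
    calc _ = ∑ k ∈ (range (n + 1)).filter (fun k => 2 ≤ k ∧ k ≤ K), (16 : ℝ) ^ k := by
          refine sum_congr rfl fun k hk => ?_
          have hk' : 0 < n.choose k := Nat.choose_pos (by
            have := mem_range.1 (mem_filter.1 hk).1; omega)
          have : (0 : ℝ) < n.choose k := by exact_mod_cast hk'
          field_simp
      _ ≤ _ := by
          refine sum_le_sum_of_subset_of_nonneg ?_ fun _ _ _ => by positivity
          intro k hk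
          rw [mem_filter] at hk
          exact mem_range.2 (by omega)
  refine le_trans (le_of_eq ?_) ((h1.trans h2).trans h3)
  congr 2
  funext φ
  rw [filter_filter]
  congr! 4
  rw [and_assoc]

/-- Each ratio C(n, y+1)/C(n, y) = (n − y)/(y + 1) with y < m is at least (n − m)/m. -/
theorem choose_mul_pow_le {n x m : ℕ} (hm : m ≤ n) (h : ℕ) (hxh : x + h ≤ m) :
    (n.choose x : ℝ) * (n - m : ℝ) ^ h ≤ n.choose (x + h) * (m : ℝ) ^ h := by
  have hnm : (0 : ℝ) ≤ n - m := sub_nonneg.2 (by exact_mod_cast hm)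
  induction h with
  | zero => simp
  | succ h ih =>
    have h1 : (n.choose (x + h + 1) : ℝ) * (x + h + 1 : ℕ) = n.choose (x + h) * (n - (x + h : ℕ)) := by
      have := Nat.choose_succ_right_eq n (x + h)
      rw [← Nat.cast_sub (by omega)]
      exact_mod_cast this
    have h2 : (n - m : ℝ) ≤ n - (x + h : ℕ) := by
      have : ((x + h : ℕ) : ℝ) ≤ m := by exact_mod_cast (by omega : x + h ≤ m)
      linarith
    have h3 : ((x + h + 1 : ℕ) : ℝ) ≤ m := by exact_mod_cast (by omega : x + h + 1 ≤ m)
    calc (n.choose x : ℝ) * (n - m : ℝ) ^ (h + 1)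
        = (n.choose x * (n - m : ℝ) ^ h) * (n - m) := by ring
      _ ≤ (n.choose (x + h) * (m : ℝ) ^ h) * (n - (x + h : ℕ)) := by
          exact mul_le_mul (ih (by omega)) h2 hnm (by positivity)
      _ = (n.choose (x + h + 1) * (x + h + 1 : ℕ)) * (m : ℝ) ^ h := by rw [h1]; ring
      _ ≤ (n.choose (x + h + 1) * m) * (m : ℝ) ^ h := by gcongr
      _ = _ := by rw [← add_assoc]; ring

theorem sq_le_two_mul_two_pow (h : ℕ) : h ^ 2 ≤ 2 * 2 ^ h := by
  rcases Nat.lt_or_ge h 3 with h3 | h3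
  · interval_cases h <;> norm_num
  · induction h, h3 using Nat.le_induction with
    | base => norm_num
    | succ k hk ih =>
      rw [pow_succ 2 k]
      nlinarith

/-- Small vertex sets do not span many more edges than vertices. -/
theorem exists_confProb_dense_le : ∃ δ : ℝ, 0 < δ ∧ ∃ C : ℝ, ∀ (n ν : ℕ) (d : Fin n → ℕ),
    0 < n → (∀ i, 3 ≤ d i ∧ d i ≤ 4) → ∑ i, d i = 2 * ν →
    confProb d ν (fun φ => ∃ X : Finset (Fin n), X.Nonempty ∧ (X.card : ℝ) ≤ δ * n ∧
      X.card + max 2 ((X.card + 24) / 25) ≤ (innerEdges φ X).card) ≤ C / n := by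
  classical
  -- The factor 16^25 absorbs 16^x because x ≤ 25h, and 6 comes from 3x/(n/2). Sets of size at most
  -- n/(2B) have Bx/n ≤ 1/2.
  obtain ⟨B, hB, hB6⟩ : ∃ B : ℝ, B = 16 ^ 25 * 6 ∧ 6 ≤ B := ⟨_, rfl, by norm_num⟩
  have hB0 : 0 < B := by linarith
  refine ⟨1 / (2 * B), by positivity, 5000 * B ^ 2, fun n ν d hn hd hsum => ?_⟩
  have hn' : (0 : ℝ) < n := by exact_mod_cast hn
  set h : ℕ → ℕ := fun x => max 2 ((x + 24) / 25) with hh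
  set p : ℕ → Prop := fun x => 0 < x ∧ (x : ℝ) ≤ 1 / (2 * B) * n with hp
  have hBx : ∀ x, p x → B * x / n ≤ 1 / 2 := by
    intro x hx
    rw [div_le_iff₀ hn']
    have := hx.2
    rw [div_mul_eq_mul_div, one_mul, le_div_iff₀ (by positivity)] at this
    linarith
  have h6 : ∀ x, p x → 6 * x ≤ n := by
    intro x hx
    have h1 := hBx x hx
    rw [div_le_iff₀ hn'] at h1
    have h2 : (6 : ℝ) * x ≤ B * x := by gcongr
    have h3 : (6 * x : ℝ) ≤ n := by linarith
    exact_mod_cast h3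
  have hhx : ∀ x, p x → x + h x ≤ 3 * x := by
    intro x hx
    have := hx.1
    simp only [hh]
    omega
  -- The term is at most (Bx/n)^h with h ≥ 2. Two factors give n⁻², and the remaining powers of 1/2
  -- beat x² since x ≤ 25h. Summing over at most n sizes leaves O(1/n).
  have hterm : ∀ x, p x → (n.choose x : ℝ) * (16 ^ x / n.choose (x + h x)) ≤
      5000 * B ^ 2 / n ^ 2 := by
    intro x hx
    have hx6 := h6 x hx
    have hx3 := hhx x hx
    have hpos : (0 : ℝ) < n.choose (x + h x) := by
      exact_mod_cast Nat.choose_pos (by omega)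
    have h1 := choose_mul_pow_le (n := n) (x := x) (m := 3 * x) (by omega) (h x) hx3
    have hx6' : (6 * x : ℝ) ≤ n := by exact_mod_cast hx6
    have h2 : (n / 2 : ℝ) ≤ n - (3 * x : ℕ) := by push_cast; linarith
    have h3 : (n.choose x : ℝ) * (n / 2 : ℝ) ^ h x ≤ n.choose (x + h x) * ((3 * x : ℕ) : ℝ) ^ h x :=
      le_trans (by gcongr) h1
    have h4 : (n.choose x : ℝ) / n.choose (x + h x) ≤ (6 * x / n) ^ h x := by
      rw [div_le_iff₀ hpos]
      have : (6 * x / n : ℝ) = ((3 * x : ℕ) : ℝ) / (n / 2) := by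
        push_cast; field_simp; ring
      rw [this, div_pow, div_mul_eq_mul_div, le_div_iff₀ (by positivity)]
      linarith
    have h5 : (16 : ℝ) ^ x ≤ (16 ^ 25) ^ h x := by
      rw [← pow_mul]
      apply pow_le_pow_right₀ (by norm_num)
      simp only [hh]
      omega
    have h7 : 2 ≤ h x := le_max_left _ _
    have hBxn : 0 ≤ B * x / n := by positivity
    have h8 : (x : ℝ) ^ 2 * (1 / 2) ^ h x ≤ 1250 := by
      have h9 : (x : ℝ) ≤ 25 * h x := by
        have : x ≤ 25 * h x := by simp only [hh]; omega
        exact_mod_cast this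
      have h10 : ((h x : ℕ) : ℝ) ^ 2 ≤ 2 * 2 ^ h x := by exact_mod_cast sq_le_two_mul_two_pow (h x)
      rw [one_div, inv_pow, ← div_eq_mul_inv, div_le_iff₀ (by positivity)]
      nlinarith [Nat.cast_nonneg (α := ℝ) x]
    calc (n.choose x : ℝ) * (16 ^ x / n.choose (x + h x))
        = 16 ^ x * ((n.choose x : ℝ) / n.choose (x + h x)) := by ring
      _ ≤ (16 ^ 25) ^ h x * (6 * x / n) ^ h x := by gcongr
      _ = (B * x / n) ^ h x := by rw [← mul_pow, hB]; ring
      _ = (B * x / n) ^ 2 * (B * x / n) ^ (h x - 2) := by rw [← pow_add]; congr 1; omega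
      _ ≤ (B * x / n) ^ 2 * (1 / 2) ^ (h x - 2) := by
          have := hBx x hx
          exact mul_le_mul_of_nonneg_left (pow_le_pow_left₀ hBxn this _) (by positivity)
      _ = (B * x / n) ^ 2 * (4 * (1 / 2) ^ h x) := by
          congr 1
          obtain ⟨k, hk⟩ := Nat.exists_eq_add_of_le h7
          rw [hk, Nat.add_sub_cancel_left, pow_add]
          norm_num
          ring
      _ = 4 * B ^ 2 / n ^ 2 * ((x : ℝ) ^ 2 * (1 / 2) ^ h x) := by ring
      _ ≤ 4 * B ^ 2 / n ^ 2 * 1250 := by gcongr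
      _ = _ := by ring
  calc _ ≤ confProb d ν (fun φ => ∃ X ∈ univ.filter (fun X : Finset (Fin n) => p X.card),
        X.card + h X.card ≤ (innerEdges φ X).card) := by
        refine confProb_mono ?_
        rintro φ - ⟨X, h1, h2, h3⟩
        exact ⟨X, mem_filter.2 ⟨mem_univ _, card_pos.2 h1, h2⟩, h3⟩
    _ ≤ ∑ X ∈ univ.filter (fun X : Finset (Fin n) => p X.card),
        confProb d ν (fun φ => X.card + h X.card ≤ (innerEdges φ X).card) :=
        confProb_exists_le _ _
    _ ≤ ∑ X ∈ univ.filter (fun X : Finset (Fin n) => p X.card),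
        (16 : ℝ) ^ X.card / n.choose (X.card + h X.card) := by
        refine sum_le_sum fun X hX => confProb_le_card_innerEdges_le hd hsum X ?_
        have hX' := (mem_filter.1 hX).2
        have := hhx _ hX'
        have := h6 _ hX'
        omega
    _ = ∑ x ∈ (range (n + 1)).filter p, n.choose x * ((16 : ℝ) ^ x / n.choose (x + h x)) :=
        sum_filter_card p (fun x => (16 : ℝ) ^ x / n.choose (x + h x))
    _ ≤ ∑ x ∈ (range (n + 1)).filter p, 5000 * B ^ 2 / n ^ 2 :=
        sum_le_sum fun x hx => hterm x (mem_filter.1 hx).2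
    _ ≤ n • (5000 * B ^ 2 / n ^ 2) := by
        rw [sum_const]
        refine nsmul_le_nsmul_left (by positivity) ?_
        have : (range (n + 1)).filter p ⊆ (range (n + 1)).erase 0 := by
          intro x hx
          rw [mem_filter] at hx
          exact mem_erase.2 ⟨hx.2.1.ne', hx.1⟩
        refine (card_le_card this).trans ?_
        rw [card_erase_of_mem (by simp), card_range]
        simp
    _ = _ := by rw [nsmul_eq_mul]; field_simp

/-! ### Sets of linear size with a small boundary -/

/-- A deviation of εn costs a factor Λ^(εn); for small ε the gain ρ^n absorbs it. -/
theorem exists_rpow_mul_lt_one {ρ : ℝ} (hρ : ρ < 1) {Λ : ℝ} (hΛ : 0 < Λ) :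
    ∀ σ : ℝ, 0 < σ → ∃ ε : ℝ, 0 < ε ∧ ε ≤ σ ∧ Λ ^ ε * ρ < 1 := by
  intro σ hσ
  have h : Filter.Tendsto (fun ε : ℝ => Λ ^ ε * ρ) (nhdsWithin 0 (Set.Ioi 0)) (nhds (1 * ρ)) := by
    have h1 : ContinuousAt (fun ε : ℝ => Λ ^ ε) 0 :=
      Real.continuousAt_const_rpow hΛ.ne'
    have h2 : Filter.Tendsto (fun ε : ℝ => Λ ^ ε) (nhdsWithin 0 (Set.Ioi 0)) (nhds 1) := by
      have := h1.tendsto.mono_left (nhdsWithin_le_nhds (s := Set.Ioi (0 : ℝ)))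
      rwa [Real.rpow_zero] at this
    exact h2.mul_const ρ
  rw [one_mul] at h
  have h3 := h.eventually (gt_mem_nhds hρ)
  have h4 : ∀ᶠ ε : ℝ in nhdsWithin 0 (Set.Ioi 0), ε ∈ Set.Ioc 0 σ := Ioc_mem_nhdsGT hσ
  obtain ⟨ε, h5, h6⟩ := (h3.and h4).exists
  exact ⟨ε, h6.1, h6.2, h5⟩

theorem exists_succ_pow_mul_pow_le {r : ℝ} (hr0 : 0 ≤ r) (hr : r < 1) (k : ℕ) :
    ∃ C : ℝ, ∀ n : ℕ, 0 < n → ((n : ℝ) + 1) ^ k * r ^ n ≤ C / n := by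
  have h := tendsto_pow_const_mul_const_pow_of_lt_one (k + 1) hr0 hr
  obtain ⟨C, hC⟩ := h.bddAbove_range
  refine ⟨2 ^ k * C, fun n hn => ?_⟩
  have hn' : (0 : ℝ) < n := by exact_mod_cast hn
  have hn1 : (1 : ℝ) ≤ n := by exact_mod_cast hn
  rw [le_div_iff₀ hn']
  have h1 : (n : ℝ) ^ (k + 1) * r ^ n ≤ C := hC ⟨n, rfl⟩
  calc ((n : ℝ) + 1) ^ k * r ^ n * n ≤ (2 * n) ^ k * r ^ n * n := by
        gcongr
        linarith
    _ = 2 ^ k * ((n : ℝ) ^ (k + 1) * r ^ n) := by rw [mul_pow]; ring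
    _ ≤ _ := by gcongr

theorem prod_pow_degree {n : ℕ} (d : Fin n → ℕ) (A : Finset (Fin n)) (x : ℝ) :
    ∏ i ∈ A, x ^ d i = x ^ (∑ i ∈ A, d i) := prod_pow_eq_pow_sum A d x

/-- The estimate C(D, 2i)/C(ν, i) becomes a product over vertices. The mode bound replaces 1/C(ν, i)
by (ν + 1) x^(2i) y^(2(ν−i)), and C(D, 2i) = C(D, m) ≤ (1 + ξ)^(4n) ξ^(−m) is a small exponential
cost when m and ξ are small. -/
theorem confProb_le_card_innerEdges_le_weight {n ν : ℕ} {d : Fin n → ℕ}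
    (hd : ∀ i, 3 ≤ d i ∧ d i ≤ 4) (hsum : ∑ i, d i = 2 * ν) (hν : 0 < ν) {i m : ℕ} (hiν : i ≤ ν)
    {A : Finset (Fin n)} (hm : ∑ v ∈ A, d v = 2 * i + m) {x y ξ x₀ : ℝ} (hx2 : x ^ 2 = i / ν)
    (hy2 : y ^ 2 = 1 - i / ν) (hξ : 0 < ξ) (hx₀ : 0 < x₀) (hxx : x₀ ≤ x) (hy0 : 0 ≤ y)
    (hy1 : y ≤ 1) :
    confProb d ν (fun φ => i ≤ (innerEdges φ A).card) ≤
      (ν + 1) * ((1 + ξ) ^ (4 * n) * (1 / (ξ * x₀)) ^ m) *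
        ((∏ v ∈ A, x ^ d v) * ∏ v ∈ univ \ A, y ^ d v) := by
  have hx0 : 0 ≤ x := by linarith
  rw [prod_pow_degree, prod_pow_degree]
  have hD : ∑ v ∈ univ \ A, d v + ∑ v ∈ A, d v = 2 * ν := by
    rw [← hsum]; exact sum_sdiff (subset_univ A)
  obtain ⟨-, hν2⟩ := card_le_of_degree hd hsum
  have hD4 : ∑ v ∈ A, d v ≤ 4 * n := by omega
  set D := ∑ v ∈ A, d v with hDdef
  have hmode := one_le_succ_mul_choose_mul hiν hν
  rw [← hx2, show 1 - x ^ 2 = y ^ 2 by rw [hx2, hy2], ← pow_mul, ← pow_mul] at hmode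
  have hU := confProb_le_card_innerEdges_mul hsum A i
  rw [← hDdef] at hU
  have hch : (D.choose (2 * i) : ℝ) * ξ ^ m ≤ (1 + ξ) ^ (4 * n) := by
    have e1 : D.choose (2 * i) = D.choose m := by
      rw [hm]; exact Nat.choose_symm_add
    have e3 : (D.choose m : ℝ) * ξ ^ m ≤ (ξ + 1) ^ D := by
      rw [add_pow ξ 1 D]
      have := single_le_sum (f := fun k => ξ ^ k * 1 ^ (D - k) * (D.choose k : ℝ))
        (s := range (D + 1)) (fun _ _ => by positivity) (mem_range.2 (by omega) : m ∈ _)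
      refine le_trans (le_of_eq ?_) this
      simp only [one_pow]; ring
    rw [e1]
    refine e3.trans ?_
    rw [add_comm]
    exact pow_le_pow_right₀ (by linarith) hD4
  have hxm : 1 ≤ (1 / (ξ * x₀)) ^ m * (ξ ^ m * x ^ m) := by
    have e2 : (ξ * x₀) ^ m ≤ ξ ^ m * x ^ m := by
      rw [← mul_pow]; gcongr
    calc (1 : ℝ) = (1 / (ξ * x₀)) ^ m * (ξ * x₀) ^ m := by
          rw [← mul_pow, div_mul_cancel₀ _ (by positivity), one_pow]
      _ ≤ _ := by gcongr
  have hxi : x ^ (2 * i) * x ^ m = x ^ D := by rw [← pow_add, ← hm]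
  have hyi : y ^ (2 * (ν - i)) ≤ y ^ (∑ v ∈ univ \ A, d v) :=
    pow_le_pow_of_le_one hy0 hy1 (by omega)
  generalize confProb d ν (fun φ => i ≤ (innerEdges φ A).card) = p at hU ⊢
  have hp0 : p * ν.choose i ≤ D.choose (2 * i) := hU
  rcases lt_or_ge p 0 with hp | hp
  · exact hp.le.trans (by positivity)
  calc p ≤ p * ((ν + 1 : ℝ) * (ν.choose i * (x ^ (2 * i) * y ^ (2 * (ν - i))))) :=
        le_mul_of_one_le_right hp hmode
    _ = (ν + 1) * ((p * ν.choose i) * (x ^ (2 * i) * y ^ (2 * (ν - i)))) := by ring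
    _ ≤ (ν + 1) * ((D.choose (2 * i)) * (x ^ (2 * i) * y ^ (2 * (ν - i)))) := by gcongr
    _ ≤ (ν + 1) * ((D.choose (2 * i)) * (x ^ (2 * i) * y ^ (2 * (ν - i)))) *
        ((1 / (ξ * x₀)) ^ m * (ξ ^ m * x ^ m)) := le_mul_of_one_le_right (by positivity) hxm
    _ = (ν + 1) * (((D.choose (2 * i)) * ξ ^ m) * (1 / (ξ * x₀)) ^ m) *
        ((x ^ (2 * i) * x ^ m) * y ^ (2 * (ν - i))) := by ring
    _ ≤ (ν + 1) * ((1 + ξ) ^ (4 * n) * (1 / (ξ * x₀)) ^ m) *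
        (x ^ D * y ^ (∑ v ∈ univ \ A, d v)) := by rw [hxi]; gcongr

/-- With high probability, no set of linear size has a sublinear edge boundary. -/
theorem exists_confProb_small_boundary_le {α : ℝ} (hα : 0 < α) (hα' : α < 1 / 2) :
    ∃ ε : ℝ, 0 < ε ∧ ∃ C : ℝ, ∀ (n ν : ℕ) (d : Fin n → ℕ),
    0 < n → (∀ i, 3 ≤ d i ∧ d i ≤ 4) → ∑ i, d i = 2 * ν →
    confProb d ν (fun φ => ∃ A : Finset (Fin n),
      ((touchingEdges φ A).card : ℝ) ≤ (innerEdges φ A).card + ε * n ∧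
      α * (2 * ν) < ((∑ i ∈ A, d i : ℕ) : ℝ) ∧ ((∑ i ∈ A, d i : ℕ) : ℝ) < (1 - α) * (2 * ν)) ≤
      C / n := by
  classical
  set ρ := √(1 - α / 2) with hρ
  have hρ1 : ρ < 1 := by
    rw [hρ, Real.sqrt_lt' one_pos]; linarith
  have hρ0 : 0 < ρ := Real.sqrt_pos.2 (by linarith)
  obtain ⟨ξ, hξ0, hξ1, hξ⟩ : ∃ ξ : ℝ, 0 < ξ ∧ ξ ≤ 1 ∧ (1 + ξ) ^ 4 * ρ < 1 := by
    have h : ContinuousAt (fun ξ : ℝ => (1 + ξ) ^ 4 * ρ) 0 := by fun_prop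
    have h1 := h.tendsto.mono_left (nhdsWithin_le_nhds (s := Set.Ioi (0 : ℝ)))
    have h3 := h1.eventually (gt_mem_nhds (show (1 + (0 : ℝ)) ^ 4 * ρ < 1 by simpa using hρ1))
    have h4 : ∀ᶠ ε : ℝ in nhdsWithin 0 (Set.Ioi 0), ε ∈ Set.Ioc (0 : ℝ) 1 := Ioc_mem_nhdsGT one_pos
    obtain ⟨ε, h5, h6⟩ := (h3.and h4).exists
    exact ⟨ε, h6.1, h6.2, h5⟩
  set x₀ := √(α / 2) with hx₀
  have hx₀0 : 0 < x₀ := Real.sqrt_pos.2 (by linarith)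
  have hx₀1 : x₀ ≤ 1 := by rw [hx₀]; exact Real.sqrt_le_one.2 (by linarith)
  set Λ := 1 / (ξ * x₀) with hΛ
  have hΛ1 : 1 ≤ Λ := by
    rw [hΛ, le_div_iff₀ (by positivity)]
    nlinarith
  obtain ⟨ε, hε0, hεα, hε⟩ := exists_rpow_mul_lt_one hξ (Λ := Λ) (by linarith) α hα
  obtain ⟨C, hC⟩ := exists_succ_pow_mul_pow_le (r := Λ ^ ε * ((1 + ξ) ^ 4 * ρ)) (by positivity) hε 2
  refine ⟨ε, hε0, 4 * C, fun n ν d hn hd hsum => ?_⟩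
  have hn' : (0 : ℝ) < n := by exact_mod_cast hn
  obtain ⟨hν1, hν2⟩ := card_le_of_degree hd hsum
  have hν : 0 < ν := by omega
  have hν' : (0 : ℝ) < ν := by exact_mod_cast hν
  have hν1' : (3 * n : ℝ) ≤ 2 * ν := by exact_mod_cast hν1
  have hν2' : (ν : ℝ) ≤ 2 * n := by exact_mod_cast hν2
  -- Fixing the number i of inner edges fixes x and y, so all sets `A` share the same vertex
  -- weights.
  set P : ℕ → Finset (Fin n) → Prop := fun i A => 2 * i ≤ ∑ v ∈ A, d v ∧
    ((∑ v ∈ A, d v : ℕ) : ℝ) ≤ 2 * i + ε * n ∧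
    α * (2 * ν) < ((∑ i ∈ A, d i : ℕ) : ℝ) ∧ ((∑ i ∈ A, d i : ℕ) : ℝ) < (1 - α) * (2 * ν) with hP
  have hi : ∀ i ∈ range (ν + 1), confProb d ν (fun φ => ∃ A ∈ univ.filter (P i),
      i ≤ (innerEdges φ A).card) ≤ (ν + 1) * (Λ ^ ε * ((1 + ξ) ^ 4 * ρ)) ^ n := by
    intro i hi
    have hiν : i ≤ ν := by rw [mem_range] at hi; omega
    rcases (univ.filter (P i)).eq_empty_or_nonempty with hemp | ⟨A₀, hA₀⟩
    · rw [hemp]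
      refine le_trans (confProb_exists_le _ _) ?_
      rw [sum_empty]
      positivity
    set θ : ℝ := i / ν with hθ
    have hθν : θ * ν = i := by rw [hθ]; field_simp
    obtain ⟨h1, h2, h3, h4⟩ := (mem_filter.1 hA₀).2
    have h1' : (2 * i : ℝ) ≤ ((∑ v ∈ A₀, d v : ℕ) : ℝ) := by exact_mod_cast h1
    -- 2i is within εn ≤ αν of the degree sum of `A₀`, so θ stays away from 0 and 1.
    have hθl : α / 2 ≤ θ := by
      rw [hθ, le_div_iff₀ hν']
      have : ε * n ≤ α * n := by gcongr
      nlinarith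
    have hθu : θ ≤ 1 - α / 2 := by
      rw [hθ, div_le_iff₀ hν']
      nlinarith
    set x := √θ with hx
    set y := √(1 - θ) with hy
    have hx2 : x ^ 2 = θ := Real.sq_sqrt (by linarith)
    have hy2 : y ^ 2 = 1 - θ := Real.sq_sqrt (by linarith)
    have hxρ : x ≤ ρ := Real.sqrt_le_sqrt hθu
    have hyρ : y ≤ ρ := Real.sqrt_le_sqrt (by linarith)
    have hx0 : 0 ≤ x := Real.sqrt_nonneg _
    have hy0 : 0 ≤ y := Real.sqrt_nonneg _
    have hxx : x₀ ≤ x := Real.sqrt_le_sqrt hθl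
    have hy1 : y ≤ 1 := by linarith
    have hA : ∀ A ∈ univ.filter (P i), confProb d ν (fun φ => i ≤ (innerEdges φ A).card) ≤
        (ν + 1) * ((1 + ξ) ^ (4 * n) * Λ ^ (ε * n)) *
          ((∏ v ∈ A, x ^ d v) * ∏ v ∈ univ \ A, y ^ d v) := by
      intro A hA
      obtain ⟨h1, h2, -, -⟩ := (mem_filter.1 hA).2
      obtain ⟨m, hm⟩ := Nat.exists_eq_add_of_le h1
      have hmε : (m : ℝ) ≤ ε * n := by
        rw [hm] at h2; push_cast at h2; linarith
      have e1 : Λ ^ m ≤ Λ ^ (ε * n) := by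
        rw [← Real.rpow_natCast]
        exact Real.rpow_le_rpow_of_exponent_le hΛ1 hmε
      refine (confProb_le_card_innerEdges_le_weight hd hsum hν hiν hm hx2 hy2 hξ0 hx₀0 hxx hy0
        hy1).trans ?_
      have e2 : 0 ≤ (∏ v ∈ A, x ^ d v) * ∏ v ∈ univ \ A, y ^ d v := by positivity
      refine mul_le_mul_of_nonneg_right (mul_le_mul_of_nonneg_left ?_ (by positivity)) e2
      exact mul_le_mul_of_nonneg_left e1 (by positivity)
    -- Degree at least three is essential: x³ + y³ ≤ ρ(x² + y²) = ρ, whereas degree two would give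
    -- weight 1.
    have hF : ∀ v, x ^ d v + y ^ d v ≤ ρ := by
      intro v
      have h3 := (hd v).1
      have hx1 : x ≤ 1 := by linarith
      have e1 : x ^ d v ≤ x ^ 3 := pow_le_pow_of_le_one hx0 hx1 h3
      have e2 : y ^ d v ≤ y ^ 3 := pow_le_pow_of_le_one hy0 hy1 h3
      have e3 : x ^ 3 ≤ ρ * x ^ 2 := by rw [pow_succ' x 2]; gcongr
      have e4 : y ^ 3 ≤ ρ * y ^ 2 := by rw [pow_succ' y 2]; gcongr
      have e5 : x ^ 2 + y ^ 2 = 1 := by rw [hx2, hy2]; ring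
      nlinarith
    calc _ ≤ ∑ A ∈ univ.filter (P i), confProb d ν (fun φ => i ≤ (innerEdges φ A).card) :=
          confProb_exists_le _ _
      _ ≤ ∑ A ∈ univ.filter (P i), (ν + 1) * ((1 + ξ) ^ (4 * n) * Λ ^ (ε * n)) *
          ((∏ v ∈ A, x ^ d v) * ∏ v ∈ univ \ A, y ^ d v) := sum_le_sum hA
      _ ≤ ∑ A, (ν + 1) * ((1 + ξ) ^ (4 * n) * Λ ^ (ε * n)) *
          ((∏ v ∈ A, x ^ d v) * ∏ v ∈ univ \ A, y ^ d v) :=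
          sum_le_sum_of_subset_of_nonneg (filter_subset _ _) fun _ _ _ => by positivity
      _ = (ν + 1) * ((1 + ξ) ^ (4 * n) * Λ ^ (ε * n)) * ∏ v, (x ^ d v + y ^ d v) := by
          rw [← mul_sum, prod_add, powerset_univ]
      _ ≤ (ν + 1) * ((1 + ξ) ^ (4 * n) * Λ ^ (ε * n)) * ρ ^ n := by
          refine mul_le_mul_of_nonneg_left ?_ (by positivity)
          have := prod_le_prod (s := univ) (f := fun v => x ^ d v + y ^ d v) (g := fun _ => ρ)
            (fun v _ => by positivity) fun v _ => hF v
          simpa using this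
      _ = _ := by
          rw [mul_pow, mul_pow, ← Real.rpow_mul_natCast (by linarith), ← pow_mul]
          ring
  calc _ ≤ confProb d ν (fun φ => ∃ i ∈ range (ν + 1), ∃ A ∈ univ.filter (P i),
        i ≤ (innerEdges φ A).card) := by
        refine confProb_mono ?_
        rintro φ hφ ⟨A, h1, h2, h3⟩
        have h4 := card_innerEdges_add_card_touchingEdges hφ A
        have h5 := card_le_card (innerEdges_subset_touchingEdges φ A)
        refine ⟨(innerEdges φ A).card, mem_range.2 ?_, A, mem_filter.2 ⟨mem_univ _, ?_, ?_, h2, h3⟩,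
          le_rfl⟩
        · have := card_le_univ (innerEdges φ A)
          rw [Fintype.card_fin] at this
          omega
        · omega
        · rw [← h4]; push_cast; linarith
    _ ≤ ∑ i ∈ range (ν + 1), confProb d ν (fun φ => ∃ A ∈ univ.filter (P i),
        i ≤ (innerEdges φ A).card) := confProb_exists_le _ _
    _ ≤ ∑ i ∈ range (ν + 1), (ν + 1) * (Λ ^ ε * ((1 + ξ) ^ 4 * ρ)) ^ n := sum_le_sum hi
    _ = (ν + 1) ^ 2 * (Λ ^ ε * ((1 + ξ) ^ 4 * ρ)) ^ n := by
        rw [sum_const, card_range, nsmul_eq_mul]; push_cast; ring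
    _ ≤ (2 * ((n : ℝ) + 1)) ^ 2 * (Λ ^ ε * ((1 + ξ) ^ 4 * ρ)) ^ n := by
        gcongr
        linarith
    _ = 4 * (((n : ℝ) + 1) ^ 2 * (Λ ^ ε * ((1 + ξ) ^ 4 * ρ)) ^ n) := by ring
    _ ≤ 4 * (C / n) := by gcongr; exact hC n hn
    _ = _ := by ring

/-! ### Independent sets with small neighborhoods -/

/-- The cubic vertex weight at `κ = 1 - 2x²`. -/
theorem cubic_weight_lt_one {x : ℝ} (hx : 0 < x) (hx2 : x ^ 2 ≤ 1 / 2) :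
    (1 - 2 * x ^ 2) ^ 3 + 16 * x ^ 3 * (1 - x ^ 2) ^ 3 < 1 := by
  set u := x ^ 2 with hu
  have hu0 : 0 < u := by positivity
  have h1 : x ≤ u + 1 / 4 := by nlinarith [sq_nonneg (x - 1 / 2)]
  have h2 : 0 < (1 - u) ^ 3 := pow_pos (by linarith) 3
  -- This expression equals 3 − 6u + 4u² − 8(u + 1/4)(1 − u)³, the gap left after x ≤ u + 1/4 makes
  -- the inequality polynomial in u.
  have h3 : 0 < (1 - u) ^ 2 * (1 - 3 * u) ^ 2 + u ^ 3 * (2 - u) :=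
    add_pos_of_nonneg_of_pos (by positivity) (mul_pos (by positivity) (by linarith))
  have h4 : 8 * x * (1 - u) ^ 3 ≤ 8 * (u + 1 / 4) * (1 - u) ^ 3 := by gcongr
  have h5 : 8 * x * (1 - u) ^ 3 < 3 - 6 * u + 4 * u ^ 2 := by nlinarith
  have h6 : x ^ 3 = u * x := by rw [hu]; ring
  rw [h6]
  nlinarith

/-- The quartic vertex weight at `κ = 1 - 2x²`. -/
theorem quartic_weight_lt_one {x : ℝ} (hx : 0 < x) (hx2 : x ^ 2 ≤ 1 / 2) :
    (1 - 2 * x ^ 2) ^ 4 + 16 * x ^ 3 * (1 - x ^ 2) ^ 4 * (1 + x ^ 2) < 1 := by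
  set u := x ^ 2 with hu
  have hu0 : 0 < u := by positivity
  have h1 : x ≤ u + 1 / 4 := by nlinarith [sq_nonneg (x - 1 / 2)]
  have h2 : 0 < (1 - u) ^ 2 := pow_pos (by linarith) 2
  -- Again the exact gap, now 1 − 2u + 2u² − 2(u + 1/4)(1 − u)².
  have h3 : 0 < (1 - 3 * u) ^ 2 / 2 + u ^ 2 * (1 - 2 * u) := by
    rcases eq_or_ne u (1 / 3) with h | h
    · rw [h]; norm_num
    · refine add_pos_of_pos_of_nonneg ?_ (mul_nonneg (by positivity) (by linarith))
      have : 1 - 3 * u ≠ 0 := fun h' => h (by linarith)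
      positivity
  have h4 : 2 * x * (1 - u) ^ 2 ≤ 2 * (u + 1 / 4) * (1 - u) ^ 2 := by gcongr
  have h5 : 2 * x * (1 - u) ^ 2 < 1 - 2 * u + 2 * u ^ 2 := by nlinarith
  have h5' : 2 * x * (1 - u) ^ 2 * (1 - u ^ 2) < 1 - 2 * u + 2 * u ^ 2 := by
    refine lt_of_le_of_lt ?_ h5
    exact mul_le_of_le_one_right (by positivity) (by nlinarith)
  have h6 : x ^ 3 = u * x := by rw [hu]; ring
  rw [h6]
  have h7 : 0 < 8 * u * (1 - u) := by
    have : 0 < 1 - u := by linarith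
    positivity
  have h8 := mul_lt_mul_of_pos_left h5' h7
  have e : (1 - 2 * u) ^ 4 + 16 * (u * x) * (1 - u) ^ 4 * (1 + u) =
    1 + 8 * u * (1 - u) * (2 * x * (1 - u) ^ 2 * (1 - u ^ 2)) -
      8 * u * (1 - u) * (1 - 2 * u + 2 * u ^ 2) := by ring
  rw [e]
  linarith

/-- Uniformly for `κ` bounded away from `1`, some tilt makes both vertex weights smaller
than `1`. -/
theorem exists_tilt {κ₀ : ℝ} (hκ₀ : κ₀ < 1) : ∃ ρ Λ : ℝ, 0 < ρ ∧ ρ < 1 ∧ 1 ≤ Λ ∧ ∀ κ : ℝ, 0 ≤ κ →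
    κ ≤ κ₀ → ∃ l : ℝ, 1 ≤ l ∧ l ≤ Λ ∧ ∀ k : ℕ, 3 ≤ k ∧ k ≤ 4 →
      κ ^ k + (l⁻¹ * (1 + κ) ^ k + l * ((1 - κ ^ 2) / 2) ^ k) ≤ ρ := by
  rcases lt_or_ge κ₀ 0 with hneg | hpos
  · exact ⟨1 / 2, 1, by norm_num, by norm_num, le_rfl, fun κ h1 h2 => by linarith⟩
  set x₀ := √((1 - κ₀) / 2) with hx₀
  have hx₀0 : 0 < x₀ := Real.sqrt_pos.2 (by linarith)
  have hx₀sq : x₀ ^ 2 = (1 - κ₀) / 2 := Real.sq_sqrt (by linarith)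
  have hx₀1 : x₀ ≤ 1 := by nlinarith
  -- Both weights tend to 1 as x → 0. Keeping x ≥ x₀ makes the range compact, and the maximum there
  -- is a uniform bound below 1.
  have hlt : ∀ x ∈ Set.Icc x₀ (√(1 / 2)),
      max ((1 - 2 * x ^ 2) ^ 3 + 16 * x ^ 3 * (1 - x ^ 2) ^ 3)
        ((1 - 2 * x ^ 2) ^ 4 + 16 * x ^ 3 * (1 - x ^ 2) ^ 4 * (1 + x ^ 2)) < 1 := by
    intro x hx
    have h0 : 0 < x := lt_of_lt_of_le hx₀0 hx.1
    have h2 : x ^ 2 ≤ 1 / 2 := by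
      have := pow_le_pow_left₀ h0.le hx.2 2
      rwa [Real.sq_sqrt (by norm_num)] at this
    exact max_lt (cubic_weight_lt_one h0 h2) (quartic_weight_lt_one h0 h2)
  have hne : (Set.Icc x₀ (√(1 / 2))).Nonempty :=
    ⟨x₀, le_rfl, Real.sqrt_le_sqrt (by linarith)⟩
  obtain ⟨z, hz, hmax⟩ := isCompact_Icc.exists_isMaxOn hne
    (f := fun x : ℝ => max ((1 - 2 * x ^ 2) ^ 3 + 16 * x ^ 3 * (1 - x ^ 2) ^ 3)
        ((1 - 2 * x ^ 2) ^ 4 + 16 * x ^ 3 * (1 - x ^ 2) ^ 4 * (1 + x ^ 2)))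
    (by fun_prop)
  set ρ := max ((1 - 2 * z ^ 2) ^ 3 + 16 * z ^ 3 * (1 - z ^ 2) ^ 3)
        ((1 - 2 * z ^ 2) ^ 4 + 16 * z ^ 3 * (1 - z ^ 2) ^ 4 * (1 + z ^ 2)) with hρ
  have hmax' : ∀ x ∈ Set.Icc x₀ (√(1 / 2)),
      max ((1 - 2 * x ^ 2) ^ 3 + 16 * x ^ 3 * (1 - x ^ 2) ^ 3)
        ((1 - 2 * x ^ 2) ^ 4 + 16 * x ^ 3 * (1 - x ^ 2) ^ 4 * (1 + x ^ 2)) ≤ ρ :=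
    fun x hx => hmax hx
  have hinv : 1 ≤ x₀⁻¹ := (one_le_inv₀ hx₀0).2 hx₀1
  refine ⟨max ρ (1 / 2), x₀⁻¹ ^ 3, lt_max_of_lt_right (by norm_num),
    max_lt (hlt z hz) (by norm_num), one_le_pow₀ hinv, fun κ hκ0 hκ => ?_⟩
  set x := √((1 - κ) / 2) with hx
  have hxx : x₀ ≤ x := Real.sqrt_le_sqrt (by linarith)
  have hx0 : 0 < x := lt_of_lt_of_le hx₀0 hxx
  have hxsq : x ^ 2 = (1 - κ) / 2 := Real.sq_sqrt (by linarith)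
  have hκx : κ = 1 - 2 * x ^ 2 := by linarith
  have hx1 : x ≤ 1 := by nlinarith
  have hxmem : x ∈ Set.Icc x₀ (√(1 / 2)) := ⟨hxx, Real.sqrt_le_sqrt (by linarith)⟩
  have hb := hmax' x hxmem
  -- Since 1 + κ = 2(1 − x²) and (1 − κ²)/2 = 2x²(1 − x²), the tilt x⁻³ equalises the two tilted
  -- terms of a cubic vertex. The same tilt has to serve quartic vertices.
  refine ⟨x⁻¹ ^ 3, one_le_pow₀ ((one_le_inv₀ hx0).2 hx1), ?_, ?_⟩
  · gcongr
  · rintro k ⟨h3, h4⟩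
    refine le_trans ?_ (le_max_left _ _)
    have hk : k = 3 ∨ k = 4 := by omega
    rcases hk with rfl | rfl
    · refine le_trans (le_of_eq ?_) ((le_max_left _ _).trans hb)
      rw [hκx]
      field_simp
      ring
    · refine le_trans (le_of_eq ?_) ((le_max_right _ _).trans hb)
      rw [hκx]
      field_simp
      ring

/-- With a, b, c the degree sums of S, T and the rest, the mode bound at b/ν = 1 − κ² produces
κ^(2(ν−b)) = κ^(a−b) κ^c when b ≤ a. The binomial theorem gives C(a, b) κ^(a−b) ≤ (1 + κ)^a, so the
whole bound splits over vertices. -/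
theorem confProb_edgesGoTo_le {n ν : ℕ} {d : Fin n → ℕ} (hsum : ∑ i, d i = 2 * ν) (hν : 0 < ν)
    {T S : Finset (Fin n)} (hTS : Disjoint T S) (hb : ∑ i ∈ T, d i ≤ ν) {κ : ℝ} (hκ : 0 ≤ κ)
    (hκ2 : κ ^ 2 = 1 - (∑ i ∈ T, d i : ℕ) / ν) :
    confProb d ν (fun φ => EdgesGoTo φ T S) ≤ (2 * ν + 1) ^ 2 *
      ((∏ i ∈ S, (1 + κ) ^ d i) * (∏ i ∈ T, ((1 - κ ^ 2) / 2) ^ d i) *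
        ∏ i ∈ univ \ (S ∪ T), κ ^ d i) := by
  rw [prod_pow_degree, prod_pow_degree, prod_pow_degree]
  have hD : ∑ i ∈ univ \ (S ∪ T), d i + (∑ i ∈ S, d i + ∑ i ∈ T, d i) = 2 * ν := by
    rw [← hsum, ← sum_union hTS.symm]; exact sum_sdiff (subset_univ _)
  have hU := confProb_edgesGoTo_mul hsum hTS hb
  have hν' : (0 : ℝ) < ν := by exact_mod_cast hν
  set b := ∑ i ∈ T, d i with hbdef
  set a := ∑ i ∈ S, d i with hadef
  set c := ∑ i ∈ univ \ (S ∪ T), d i with hcdef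
  have hmode := one_le_succ_mul_choose_mul hb hν
  have hb' : (b : ℝ) ≤ ν := by exact_mod_cast hb
  have hθ : (b : ℝ) / ν = 1 - κ ^ 2 := by linarith
  have hθ0 : 0 ≤ 1 - κ ^ 2 := by rw [← hθ]; positivity
  rw [hθ, sub_sub_cancel, ← pow_mul] at hmode
  generalize confProb d ν (fun φ => EdgesGoTo φ T S) = p at hU ⊢
  rcases lt_or_ge p 0 with hp | hp
  · exact hp.le.trans (by positivity)
  have hch : (a.choose b : ℝ) * κ ^ (2 * (ν - b)) ≤ (1 + κ) ^ a * κ ^ c := by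
    rcases lt_or_ge a b with hab | hab
    · rw [Nat.choose_eq_zero_of_lt hab]
      simp only [Nat.cast_zero, zero_mul]
      positivity
    · have e1 : 2 * (ν - b) = (a - b) + c := by omega
      rw [e1, pow_add, ← mul_assoc]
      gcongr
      rw [add_pow]
      have := single_le_sum (f := fun k => 1 ^ k * κ ^ (a - k) * (a.choose k : ℝ))
        (s := range (a + 1)) (fun _ _ => by positivity) (mem_range.2 (by omega) : b ∈ _)
      refine le_trans (le_of_eq ?_) this
      simp only [one_pow]; ring
  have h2b : (2 : ℝ) ^ b * (1 / 2) ^ b = 1 := by rw [← mul_pow]; norm_num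
  calc p ≤ p * ((ν + 1 : ℝ) * (ν.choose b * ((1 - κ ^ 2) ^ b * κ ^ (2 * (ν - b))))) :=
        le_mul_of_one_le_right hp hmode
    _ = (ν + 1) * ((p * (ν.choose b * 2 ^ b)) * ((1 - κ ^ 2) ^ b * (1 / 2) ^ b * κ ^ (2 * (ν - b)))) := by
        linear_combination (-(p * ((ν + 1 : ℝ) * (ν.choose b * ((1 - κ ^ 2) ^ b * κ ^ (2 * (ν - b))))))) * h2b
    _ ≤ (ν + 1) * (((2 * b + 1) * a.choose b) *
        ((1 - κ ^ 2) ^ b * (1 / 2) ^ b * κ ^ (2 * (ν - b)))) := by gcongr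
    _ = (ν + 1) * (2 * b + 1) * ((a.choose b * κ ^ (2 * (ν - b))) * ((1 - κ ^ 2) / 2) ^ b) := by
        rw [div_pow, div_pow, one_pow]; ring
    _ ≤ (2 * ν + 1) * (2 * ν + 1) * (((1 + κ) ^ a * κ ^ c) * ((1 - κ ^ 2) / 2) ^ b) := by
        gcongr
        linarith
    _ = _ := by ring

/-- A disjoint pair S, T is coded as S ⊆ U with T = U ∖ S; each vertex then chooses independently
between S, T and the rest. -/
theorem sum_sigma_powerset_prod {n : ℕ} (u v w : Fin n → ℝ) :
    ∑ x ∈ (univ : Finset (Finset (Fin n))).sigma (fun U => U.powerset),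
      (∏ i ∈ x.2, u i) * (∏ i ∈ x.1 \ x.2, v i) * ∏ i ∈ univ \ x.1, w i =
      ∏ i, (w i + (u i + v i)) := by
  rw [sum_sigma]
  have h : ∀ i, w i + (u i + v i) = (u i + v i) + w i := fun i => add_comm _ _
  simp_rw [h]
  rw [prod_add, powerset_univ]
  refine sum_congr rfl fun U _ => ?_
  rw [prod_add, sum_mul]

/-- With high probability, no independent set of linear size has a neighborhood that is
essentially as small as itself. -/
theorem exists_confProb_edgesGoTo_le {σ : ℝ} (hσ : 0 < σ) :
    ∃ ε : ℝ, 0 < ε ∧ ∃ C : ℝ, ∀ (n ν : ℕ) (d : Fin n → ℕ),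
    0 < n → (∀ i, 3 ≤ d i ∧ d i ≤ 4) → ∑ i, d i = 2 * ν →
    confProb d ν (fun φ => ∃ S T : Finset (Fin n), Disjoint S T ∧ EdgesGoTo φ T S ∧
      σ * n ≤ S.card ∧ (S.card : ℝ) ≤ T.card + ε * n) ≤ C / n := by
  classical
  -- With ε ≤ σ/2, |T| ≥ σn/2, so its degree sum is at least 3σn/2 ≥ 3σν/4; this keeps κ away from
  -- 1.
  have hκ₀ : √(1 - 3 / 4 * σ) < 1 := by rw [Real.sqrt_lt' one_pos]; linarith
  obtain ⟨ρ, Λ, hρ0, hρ1, hΛ1, htilt⟩ := exists_tilt hκ₀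
  obtain ⟨ε, hε0, hεσ, hε⟩ := exists_rpow_mul_lt_one hρ1 (Λ := Λ) (by linarith) (σ / 2) (by linarith)
  obtain ⟨C, hC⟩ := exists_succ_pow_mul_pow_le (r := Λ ^ ε * ρ) (by positivity) hε 3
  refine ⟨ε, hε0, 64 * C, fun n ν d hn hd hsum => ?_⟩
  have hn' : (0 : ℝ) < n := by exact_mod_cast hn
  obtain ⟨hν1, hν2⟩ := card_le_of_degree hd hsum
  have hν : 0 < ν := by omega
  have hν' : (0 : ℝ) < ν := by exact_mod_cast hν
  have hν2' : (ν : ℝ) ≤ 2 * n := by exact_mod_cast hν2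
  set s := (univ : Finset (Finset (Fin n))).sigma (fun U => U.powerset) with hs
  set P : ℕ → (Σ _ : Finset (Fin n), Finset (Fin n)) → Prop := fun b x =>
    ∑ i ∈ x.1 \ x.2, d i = b ∧ σ * n ≤ x.2.card ∧ (x.2.card : ℝ) ≤ (x.1 \ x.2).card + ε * n with hP
  have hb : ∀ b ∈ range (ν + 1), confProb d ν (fun φ => ∃ x ∈ s.filter (P b),
      EdgesGoTo φ (x.1 \ x.2) x.2) ≤ (2 * ν + 1) ^ 2 * (Λ ^ ε * ρ) ^ n := by
    intro b hb
    have hbν : b ≤ ν := by rw [mem_range] at hb; omega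
    rcases (s.filter (P b)).eq_empty_or_nonempty with hemp | ⟨x₀, hx₀⟩
    · rw [hemp]
      refine le_trans (confProb_exists_le _ _) ?_
      rw [sum_empty]
      positivity
    obtain ⟨h1, h2, h3⟩ := (mem_filter.1 hx₀).2
    have hbσ : 3 / 4 * σ ≤ (b : ℝ) / ν := by
      have h4 := Finset.card_nsmul_le_sum (x₀.1 \ x₀.2) d 3 fun i _ => (hd i).1
      rw [h1, smul_eq_mul] at h4
      have h4' : ((x₀.1 \ x₀.2).card : ℝ) * 3 ≤ b := by exact_mod_cast h4
      have h5 : ε * n ≤ σ / 2 * n := by gcongr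
      rw [le_div_iff₀ hν']
      nlinarith
    have hb' : (b : ℝ) ≤ ν := by exact_mod_cast hbν
    have hb1 : (b : ℝ) / ν ≤ 1 := by rw [div_le_one hν']; exact hb'
    set κ := √(1 - b / ν) with hκ
    have hκ0 : 0 ≤ κ := Real.sqrt_nonneg _
    have hκ2 : κ ^ 2 = 1 - b / ν := Real.sq_sqrt (by linarith)
    have hB0 : 0 ≤ (1 - κ ^ 2) / 2 := by rw [hκ2, sub_sub_cancel]; positivity
    obtain ⟨l, hl1, hlΛ, hl⟩ := htilt κ hκ0 (Real.sqrt_le_sqrt (by linarith))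
    have hl0 : 0 < l := by linarith
    have hx : ∀ x ∈ s.filter (P b), confProb d ν (fun φ => EdgesGoTo φ (x.1 \ x.2) x.2) ≤
        (2 * ν + 1) ^ 2 * Λ ^ (ε * n) * ((∏ i ∈ x.2, l⁻¹ * (1 + κ) ^ d i) *
          (∏ i ∈ x.1 \ x.2, l * ((1 - κ ^ 2) / 2) ^ d i) * ∏ i ∈ univ \ x.1, κ ^ d i) := by
      rintro ⟨U, S⟩ hx
      rw [mem_filter, hs, mem_sigma, mem_powerset] at hx
      obtain ⟨⟨-, hSU⟩, h1, -, h3⟩ := hx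
      dsimp only at hSU h1 h3 ⊢
      have hle := confProb_edgesGoTo_le hsum hν (T := U \ S) (S := S) sdiff_disjoint
        (by rw [h1]; exact hbν) hκ0 (by rw [h1]; exact hκ2)
      rw [union_sdiff_of_subset hSU] at hle
      refine hle.trans ?_
      rw [prod_mul_distrib, prod_mul_distrib, prod_const, prod_const]
      -- Since |S| ≤ |T| + εn, inserting the tilt l^(|T|−|S|) costs at most Λ^(εn).
      have hw : 1 ≤ Λ ^ (ε * n) * (l⁻¹ ^ S.card * l ^ (U \ S).card) := by
        have e1 : l ^ (ε * n) ≤ Λ ^ (ε * n) := Real.rpow_le_rpow hl0.le hlΛ (by positivity)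
        have e2 : l ^ (S.card : ℝ) ≤ l ^ (((U \ S).card : ℝ) + ε * n) :=
          Real.rpow_le_rpow_of_exponent_le hl1 h3
        rw [Real.rpow_add hl0, Real.rpow_natCast, Real.rpow_natCast] at e2
        calc (1 : ℝ) = l⁻¹ ^ S.card * l ^ S.card := by
              rw [← mul_pow, inv_mul_cancel₀ hl0.ne', one_pow]
          _ ≤ l⁻¹ ^ S.card * (l ^ (U \ S).card * Λ ^ (ε * n)) := by
              refine mul_le_mul_of_nonneg_left (e2.trans ?_) (by positivity)
              exact mul_le_mul_of_nonneg_left e1 (by positivity)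
          _ = _ := by ring
      have hX : 0 ≤ (2 * (ν : ℝ) + 1) ^ 2 * ((∏ i ∈ S, (1 + κ) ^ d i) *
          (∏ i ∈ U \ S, ((1 - κ ^ 2) / 2) ^ d i) * ∏ i ∈ univ \ U, κ ^ d i) := by positivity
      refine (le_mul_of_one_le_right hX hw).trans (le_of_eq ?_)
      ring
    calc _ ≤ ∑ x ∈ s.filter (P b), confProb d ν (fun φ => EdgesGoTo φ (x.1 \ x.2) x.2) :=
          confProb_exists_le _ _
      _ ≤ ∑ x ∈ s.filter (P b), (2 * ν + 1) ^ 2 * Λ ^ (ε * n) *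
          ((∏ i ∈ x.2, l⁻¹ * (1 + κ) ^ d i) *
          (∏ i ∈ x.1 \ x.2, l * ((1 - κ ^ 2) / 2) ^ d i) * ∏ i ∈ univ \ x.1, κ ^ d i) :=
          sum_le_sum hx
      _ ≤ ∑ x ∈ s, (2 * ν + 1) ^ 2 * Λ ^ (ε * n) * ((∏ i ∈ x.2, l⁻¹ * (1 + κ) ^ d i) *
          (∏ i ∈ x.1 \ x.2, l * ((1 - κ ^ 2) / 2) ^ d i) * ∏ i ∈ univ \ x.1, κ ^ d i) :=
          sum_le_sum_of_subset_of_nonneg (filter_subset _ _) fun _ _ _ => by positivity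
      _ = (2 * ν + 1) ^ 2 * Λ ^ (ε * n) * ∏ i, (κ ^ d i + (l⁻¹ * (1 + κ) ^ d i +
          l * ((1 - κ ^ 2) / 2) ^ d i)) := by
          rw [← mul_sum, hs, sum_sigma_powerset_prod (fun i => l⁻¹ * (1 + κ) ^ d i)
            (fun i => l * ((1 - κ ^ 2) / 2) ^ d i) (fun i => κ ^ d i)]
      _ ≤ (2 * ν + 1) ^ 2 * Λ ^ (ε * n) * ρ ^ n := by
          refine mul_le_mul_of_nonneg_left ?_ (by positivity)
          have := prod_le_prod (s := univ) (f := fun i => κ ^ d i + (l⁻¹ * (1 + κ) ^ d i +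
            l * ((1 - κ ^ 2) / 2) ^ d i)) (g := fun _ => ρ)
            (fun i _ => by positivity) fun i _ => hl (d i) (hd i)
          simpa using this
      _ = _ := by
          rw [mul_pow, ← Real.rpow_mul_natCast (by linarith)]
          ring
  calc _ ≤ confProb d ν (fun φ => ∃ b ∈ range (ν + 1), ∃ x ∈ s.filter (P b),
        EdgesGoTo φ (x.1 \ x.2) x.2) := by
        refine confProb_mono ?_
        rintro φ hφ ⟨S, T, hST, hgo, h1, h2⟩
        have hT : (S ∪ T) \ S = T := union_sdiff_cancel_left hST
        refine ⟨∑ i ∈ T, d i, mem_range.2 ?_, ⟨S ∪ T, S⟩, mem_filter.2 ⟨?_, ?_, h1, ?_⟩, ?_⟩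
        · rw [← hgo.card_touchingEdges hφ hST.symm]
          have := card_le_univ (touchingEdges φ T)
          rw [Fintype.card_fin] at this
          omega
        · rw [hs, mem_sigma, mem_powerset]
          exact ⟨mem_univ _, subset_union_left⟩
        · rw [hT]
        · rw [hT]; exact h2
        · rw [hT]; exact hgo
    _ ≤ ∑ b ∈ range (ν + 1), confProb d ν (fun φ => ∃ x ∈ s.filter (P b),
        EdgesGoTo φ (x.1 \ x.2) x.2) := confProb_exists_le _ _
    _ ≤ ∑ b ∈ range (ν + 1), (2 * ν + 1) ^ 2 * (Λ ^ ε * ρ) ^ n := sum_le_sum hb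
    _ = (ν + 1) * (2 * ν + 1) ^ 2 * (Λ ^ ε * ρ) ^ n := by
        rw [sum_const, card_range, nsmul_eq_mul]; push_cast; ring
    _ ≤ (4 * ((n : ℝ) + 1)) * (4 * ((n : ℝ) + 1)) ^ 2 * (Λ ^ ε * ρ) ^ n := by
        gcongr <;> linarith
    _ = 64 * (((n : ℝ) + 1) ^ 3 * (Λ ^ ε * ρ) ^ n) := by ring
    _ ≤ 64 * (C / n) := by gcongr; exact hC n hn
    _ = _ := by ring

/-! ### Loops and switchings -/

theorem confProb_eq_div {n ν : ℕ} {d : Fin n → ℕ} (E : (Fin (2 * ν) → Fin n) → Prop)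
    [DecidablePred E] : confProb d ν E = (((cfg d ν).filter E).card : ℝ) / (cfg d ν).card := by
  unfold confProb
  congr!

/-- The loops of a configuration. -/
def loopEdges {n ν : ℕ} (φ : Fin (2 * ν) → Fin n) : Finset (Fin ν) :=
  univ.filter fun j => φ (firstPoint j) = φ (secondPoint j)

theorem confProb_loop_le {n ν : ℕ} {d : Fin n → ℕ} (hd : ∀ i, 3 ≤ d i ∧ d i ≤ 4)
    (hsum : ∑ i, d i = 2 * ν) (j : Fin ν) :
    confProb d ν (fun φ => φ (firstPoint j) = φ (secondPoint j)) ≤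
      n * (6 / (2 * ν).choose 2) := by
  classical
  have hν : 0 < ν := by have := j.isLt; omega
  have hpos : (0 : ℝ) < (2 * ν).choose 2 := by exact_mod_cast Nat.choose_pos (by omega)
  calc _ ≤ confProb d ν (fun φ => ∃ i ∈ (univ : Finset (Fin n)),
        ∀ p ∈ ({firstPoint j, secondPoint j} : Finset _), φ p ∈ ({i} : Finset _)) := by
        refine confProb_mono fun φ _ h => ⟨φ (firstPoint j), mem_univ _, ?_⟩
        simp [h]
    _ ≤ ∑ i ∈ (univ : Finset (Fin n)), confProb d ν (fun φ =>
        ∀ p ∈ ({firstPoint j, secondPoint j} : Finset _), φ p ∈ ({i} : Finset _)) :=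
        confProb_exists_le _ _
    _ ≤ ∑ i ∈ (univ : Finset (Fin n)), (6 : ℝ) / (2 * ν).choose 2 := by
        refine sum_le_sum fun i _ => ?_
        have h := confProb_over_mul hsum (I := {firstPoint j, secondPoint j}) (I' := ∅)
          (disjoint_empty_right _) (T := {i}) (S := ∅) (disjoint_empty_right _)
        rw [card_pair (firstPoint_ne_secondPoint j j), sum_singleton] at h
        simp only [notMem_empty, false_imp_iff, implies_true, and_true, card_empty,
          Nat.choose_zero_right, mul_one] at h
        rw [le_div_iff₀ hpos, h]
        have : (d i).choose 2 ≤ Nat.choose 4 2 := Nat.choose_le_choose 2 (hd i).2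
        have h6 : Nat.choose 4 2 = 6 := by decide
        rw [h6] at this
        exact_mod_cast this
    _ = _ := by simp

/-- The expected number of loops is at most 6n/(2ν − 1) ≤ 3; Markov's inequality does the rest. -/
theorem confProb_six_le_card_loopEdges_le {n ν : ℕ} {d : Fin n → ℕ} (hn : 0 < n)
    (hd : ∀ i, 3 ≤ d i ∧ d i ≤ 4) (hsum : ∑ i, d i = 2 * ν) :
    confProb d ν (fun φ => 6 ≤ (loopEdges φ).card) ≤ 1 / 2 := by
  classical
  obtain ⟨hν1, -⟩ := card_le_of_degree hd hsum
  have hν : 0 < ν := by omega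
  have h1 := confProb_card_ge_mul_le (d := d) (ν := ν) univ
    (fun (j : Fin ν) φ => φ (firstPoint j) = φ (secondPoint j)) 6
  have h2 := sum_le_sum (s := univ) fun j _ => confProb_loop_le hd hsum (n := n) j
  have h3 : (n : ℝ) * (6 / (2 * ν).choose 2) * ν ≤ 3 := by
    have hc : (2 * ν).choose 2 = ν * (2 * ν - 1) := by
      rw [Nat.choose_two_right, mul_assoc, Nat.mul_div_cancel_left _ (by norm_num)]
    have hν' : (0 : ℝ) < ν := by exact_mod_cast hν
    have h4 : (2 * n : ℝ) ≤ ((2 * ν - 1 : ℕ) : ℝ) := by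
      exact_mod_cast (by omega : 2 * n ≤ 2 * ν - 1)
    have hn' : (0 : ℝ) < n := by exact_mod_cast hn
    have h5 : (0 : ℝ) < ((2 * ν - 1 : ℕ) : ℝ) := by linarith
    rw [hc]
    push_cast
    rw [show (n : ℝ) * (6 / (ν * ((2 * ν - 1 : ℕ) : ℝ))) * ν = 6 * n / ((2 * ν - 1 : ℕ) : ℝ) by
      field_simp, div_le_iff₀ h5]
    linarith
  simp only [sum_const, card_univ, Fintype.card_fin, nsmul_eq_mul] at h2
  have h6 : confProb d ν (fun φ => 6 ≤ (loopEdges φ).card) ≤ confProb d ν (fun φ =>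
      (6 : ℝ) ≤ (univ.filter fun j : Fin ν => φ (firstPoint j) = φ (secondPoint j)).card) := by
    refine confProb_mono fun φ _ h => ?_
    have : (6 : ℝ) ≤ (loopEdges φ).card := by exact_mod_cast h
    refine this.trans (le_of_eq ?_)
    unfold loopEdges
    congr!
  have h7 : confProb d ν (fun φ => (6 : ℝ) ≤
      (univ.filter fun j : Fin ν => φ (firstPoint j) = φ (secondPoint j)).card) * 6 ≤ 3 := by
    refine le_trans (le_trans (le_of_eq ?_) (h1.trans h2)) (by linarith)
    congr!
  linarith

/-- Switching a loop with a disjoint edge. -/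
theorem loopEdges_comp_swap {n ν : ℕ} {φ : Fin (2 * ν) → Fin n} {j k : Fin ν}
    (hj : φ (firstPoint j) = φ (secondPoint j)) (hk : φ (firstPoint k) ≠ φ (secondPoint k))
    (h1 : φ (firstPoint k) ≠ φ (firstPoint j)) (h2 : φ (secondPoint k) ≠ φ (firstPoint j)) :
    loopEdges (φ ∘ Equiv.swap (secondPoint j) (firstPoint k)) = (loopEdges φ).erase j ∧
    (φ ∘ Equiv.swap (secondPoint j) (firstPoint k)) (firstPoint j) =
      (φ ∘ Equiv.swap (secondPoint j) (firstPoint k)) (firstPoint k) := by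
  have hjk : j ≠ k := by rintro rfl; exact hk hj
  have hf : ∀ i, i ≠ k → Equiv.swap (secondPoint j) (firstPoint k) (firstPoint i) = firstPoint i :=
    fun i hi => Equiv.swap_apply_of_ne_of_ne (firstPoint_ne_secondPoint i j)
      (fun h => hi (firstPoint_injective h))
  have hs : ∀ i, i ≠ j → Equiv.swap (secondPoint j) (firstPoint k) (secondPoint i) = secondPoint i :=
    fun i hi => Equiv.swap_apply_of_ne_of_ne (fun h => hi (secondPoint_injective h))
      (firstPoint_ne_secondPoint k i).symm
  constructor
  · ext i
    simp only [loopEdges, mem_filter, mem_univ, true_and, mem_erase, Function.comp_apply]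
    rcases eq_or_ne i j with rfl | hij
    · rw [hf i hjk, Equiv.swap_apply_left]
      simp only [ne_eq, not_true_eq_false, false_and, iff_false]
      exact h1.symm
    · rw [hs i hij]
      rcases eq_or_ne i k with rfl | hik
      · rw [Equiv.swap_apply_right, ← hj]
        simp only [hij, hk, and_false, iff_false, ne_eq]
        exact h2.symm
      · rw [hf i hik]
        simp [hij]
  · simp only [Function.comp_apply]
    rw [hf j hjk, Equiv.swap_apply_right, hj]

/-- Double counting of switchings. A configuration with l + 1 loops admits at least ν − l − 5 of
them: one loop is fixed, and loops and edges at its vertex are excluded as partners. A configuration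
with l loops arises from at most 4ν, since each vertex has at most four points. -/
theorem card_loopEdges_succ_le {n ν : ℕ} {d : Fin n → ℕ} (hd : ∀ i, 3 ≤ d i ∧ d i ≤ 4)
    {l : ℕ} (hl : l ≤ 4) (hν : 18 ≤ ν) :
    ((cfg d ν).filter fun φ => (loopEdges φ).card = l + 1).card ≤
      8 * ((cfg d ν).filter fun φ => (loopEdges φ).card = l).card := by
  classical
  set Q : Finset (Σ _ : Fin (2 * ν) → Fin n, Fin ν × Fin ν) :=
    ((cfg d ν).filter fun φ => (loopEdges φ).card = l + 1).sigma fun φ =>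
      univ.filter fun p => φ (firstPoint p.1) = φ (secondPoint p.1) ∧
        φ (firstPoint p.2) ≠ φ (secondPoint p.2) ∧ φ (firstPoint p.2) ≠ φ (firstPoint p.1) ∧
        φ (secondPoint p.2) ≠ φ (firstPoint p.1) with hQ
  set R : Finset (Σ _ : Fin (2 * ν) → Fin n, Fin ν × Fin ν) :=
    ((cfg d ν).filter fun φ => (loopEdges φ).card = l).sigma fun φ =>
      univ.filter fun p => φ (firstPoint p.1) = φ (firstPoint p.2) with hR
  have hQR : Q.card ≤ R.card := by
    refine card_le_card_of_injOn
      (fun x => ⟨x.1 ∘ Equiv.swap (secondPoint x.2.1) (firstPoint x.2.2), x.2⟩) ?_ ?_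
    · rintro ⟨φ, j, k⟩ hx
      simp only [hQ, mem_coe, mem_sigma, mem_filter, mem_univ, true_and] at hx
      obtain ⟨⟨hφ, hc⟩, hj, hk, h1, h2⟩ := hx
      obtain ⟨e1, e2⟩ := loopEdges_comp_swap hj hk h1 h2
      simp only [hR, mem_coe, mem_sigma, mem_filter, mem_univ, true_and]
      refine ⟨⟨comp_perm_mem_cfg _ hφ, ?_⟩, e2⟩
      rw [e1, card_erase_of_mem (by simpa [loopEdges] using hj), hc]
      rfl
    · rintro ⟨φ, p⟩ - ⟨φ', p'⟩ - h
      simp only [Sigma.mk.injEq, heq_eq_eq] at h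
      obtain ⟨h1, rfl⟩ := h
      congr 1
      funext w
      have := congrFun h1 (Equiv.swap (secondPoint p.1) (firstPoint p.2) w)
      simpa using this
  have hQ' : ((cfg d ν).filter fun φ => (loopEdges φ).card = l + 1).card * (ν - l - 5) ≤ Q.card := by
    rw [hQ, card_sigma, ← smul_eq_mul]
    refine card_nsmul_le_sum _ _ _ fun φ hφ => ?_
    rw [mem_filter, mem_cfg] at hφ
    obtain ⟨hφ, hc⟩ := hφ
    obtain ⟨j, hj⟩ : (loopEdges φ).Nonempty := card_pos.1 (by omega)
    have hj' : φ (firstPoint j) = φ (secondPoint j) := by simpa [loopEdges] using hj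
    have ht : (touchingEdges φ {φ (firstPoint j)}).card ≤ 4 := by
      have h1 := card_innerEdges_add_card_touchingEdges hφ {φ (firstPoint j)}
      rw [sum_singleton] at h1
      have := (hd (φ (firstPoint j))).2
      omega
    have hsub : ({j} : Finset (Fin ν)) ×ˢ (univ \ (loopEdges φ ∪ touchingEdges φ {φ (firstPoint j)}))
        ⊆ univ.filter fun p => φ (firstPoint p.1) = φ (secondPoint p.1) ∧
          φ (firstPoint p.2) ≠ φ (secondPoint p.2) ∧ φ (firstPoint p.2) ≠ φ (firstPoint p.1) ∧
          φ (secondPoint p.2) ≠ φ (firstPoint p.1) := by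
      rintro ⟨a, b⟩ hab
      simp only [loopEdges, touchingEdges, mem_product, mem_singleton, mem_sdiff, mem_univ, true_and,
        mem_union, mem_filter, not_or] at hab ⊢
      obtain ⟨rfl, h1, h2, h3⟩ := hab
      exact ⟨hj', h1, h2, h3⟩
    refine le_trans ?_ (card_le_card hsub)
    rw [card_product, card_singleton, one_mul]
    have h2 := card_union_le (loopEdges φ) (touchingEdges φ {φ (firstPoint j)})
    have h3 := le_card_sdiff (loopEdges φ ∪ touchingEdges φ {φ (firstPoint j)}) (univ : Finset (Fin ν))
    rw [card_univ, Fintype.card_fin] at h3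
    omega
  have hR' : R.card ≤ ((cfg d ν).filter fun φ => (loopEdges φ).card = l).card * (4 * ν) := by
    rw [hR, card_sigma]
    refine (sum_le_card_nsmul _ _ (4 * ν) fun φ hφ => ?_).trans (le_of_eq (smul_eq_mul _ _))
    rw [mem_filter, mem_cfg] at hφ
    have : (univ.filter fun p : Fin ν × Fin ν => φ (firstPoint p.1) = φ (firstPoint p.2)) ⊆
        (univ : Finset (Fin ν)).biUnion fun j => ({j} : Finset (Fin ν)) ×ˢ
          touchingEdges φ {φ (firstPoint j)} := by
      rintro ⟨a, b⟩ hab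
      simp only [mem_filter, mem_univ, true_and] at hab
      simp [touchingEdges, hab]
    refine (card_le_card this).trans (card_biUnion_le.trans ?_)
    refine (sum_le_card_nsmul _ _ 4 fun j _ => ?_).trans ?_
    · rw [card_product, card_singleton, one_mul]
      have h1 := card_innerEdges_add_card_touchingEdges hφ.1 {φ (firstPoint j)}
      rw [sum_singleton] at h1
      have := (hd (φ (firstPoint j))).2
      omega
    · simp [mul_comm]
  have h := hQ'.trans (hQR.trans hR')
  set a := ((cfg d ν).filter fun φ => (loopEdges φ).card = l + 1).card
  set b := ((cfg d ν).filter fun φ => (loopEdges φ).card = l).card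
  -- The bounds ν ≥ 18 and l ≤ 4 are exactly what this needs; 4ν against ν/2 yields the factor 8.
  have h1 : ν ≤ 2 * (ν - l - 5) := by omega
  have h2 : a * ν ≤ a * (2 * (ν - l - 5)) := Nat.mul_le_mul_left _ h1
  have h3 : a * ν ≤ (8 * b) * ν := by nlinarith
  exact Nat.le_of_mul_le_mul_right h3 (by omega)

/-- A random configuration is loopless with probability bounded away from `0`. -/
theorem confProb_loopless_ge {n ν : ℕ} {d : Fin n → ℕ} (hn : 12 ≤ n)
    (hd : ∀ i, 3 ≤ d i ∧ d i ≤ 4) (hsum : ∑ i, d i = 2 * ν) :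
    1 / (12 * 8 ^ 5) ≤ confProb d ν (fun φ => loopEdges φ = ∅) := by
  classical
  obtain ⟨hν1, -⟩ := card_le_of_degree hd hsum
  have hν : 18 ≤ ν := by omega
  set a : ℕ → ℕ := fun l => ((cfg d ν).filter fun φ => (loopEdges φ).card = l).card with ha
  have hstep : ∀ l ≤ 4, a (l + 1) ≤ 8 * a l := fun l hl => card_loopEdges_succ_le hd hl hν
  have h0 := hstep 0 (by norm_num)
  have h1 := hstep 1 (by norm_num)
  have h2 := hstep 2 (by norm_num)
  have h3 := hstep 3 (by norm_num)
  have h4 := hstep 4 (by norm_num)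
  have hpos : 0 < (cfg d ν).card := card_pos.2 (cfg_nonempty hsum)
  have hpos' : (0 : ℝ) < (cfg d ν).card := by exact_mod_cast hpos
  have hcov : (cfg d ν).card ≤ ∑ l ∈ range 6, a l +
      ((cfg d ν).filter fun φ => 6 ≤ (loopEdges φ).card).card := by
    have hsub : cfg d ν ⊆ ((range 6).biUnion fun l =>
        (cfg d ν).filter fun φ => (loopEdges φ).card = l) ∪
        (cfg d ν).filter fun φ => 6 ≤ (loopEdges φ).card := by
      intro φ hφ
      rw [mem_union, mem_biUnion, mem_filter]
      rcases lt_or_ge (loopEdges φ).card 6 with h | h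
      · exact Or.inl ⟨_, mem_range.2 h, mem_filter.2 ⟨hφ, rfl⟩⟩
      · exact Or.inr ⟨hφ, h⟩
    exact (card_le_card hsub).trans ((card_union_le _ _).trans
      (Nat.add_le_add_right card_biUnion_le _))
  have h6 := confProb_six_le_card_loopEdges_le (by omega) hd hsum
  rw [confProb_eq_div, div_le_iff₀ hpos'] at h6
  rw [confProb_eq_div, le_div_iff₀ hpos']
  have h6' : 2 * ((cfg d ν).filter fun φ => 6 ≤ (loopEdges φ).card).card ≤ (cfg d ν).card := by
    have : 2 * (((cfg d ν).filter fun φ => 6 ≤ (loopEdges φ).card).card : ℝ) ≤ (cfg d ν).card := by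
      linarith
    exact_mod_cast this
  simp only [sum_range_succ, sum_range_zero] at hcov
  -- At least half of the configurations have at most five loops, and 1 + 8 + ⋯ + 8⁵ ≤ 6·8⁵.
  have hfin : (cfg d ν).card ≤ 12 * 8 ^ 5 * a 0 := by norm_num at *; omega
  have hfin' : ((cfg d ν).card : ℝ) ≤ 12 * 8 ^ 5 * (a 0 : ℝ) := by exact_mod_cast hfin
  have ha0 : a 0 = ((cfg d ν).filter fun φ => loopEdges φ = ∅).card := by
    simp only [ha, card_eq_zero]
  rw [ha0] at hfin'
  linarith

theorem configGraph_loopless_iff {n ν : ℕ} (φ : Fin (2 * ν) → Fin n) :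
    (configGraph φ).Loopless ↔ loopEdges φ = ∅ := by
  rw [Finset.eq_empty_iff_forall_notMem]
  constructor
  · intro h j hj
    have hj' : φ (firstPoint j) = φ (secondPoint j) := by simpa [loopEdges] using hj
    refine h.not_isLoopAt j (φ (firstPoint j)) ?_
    change s(φ (firstPoint j), φ (secondPoint j)) = s(φ (firstPoint j), φ (firstPoint j))
    rw [hj']
  · intro h
    refine ⟨fun j x hx => h j ?_⟩
    have hx' : s(φ (firstPoint j), φ (secondPoint j)) = s(x, x) := hx
    rw [Sym2.eq_iff] at hx'
    simp only [loopEdges, mem_filter, mem_univ, true_and]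
    rcases hx' with h | h <;> rw [h.1, h.2]

/-- The loopless law in terms of the uniform law. -/
theorem looplessConfigLaw_real {n ν : ℕ} (d : Fin n → ℕ) (E : Set (Fin (2 * ν) → Fin n))
    (h0 : 0 < confProb d ν (fun φ => loopEdges φ = ∅)) :
    (looplessConfigLaw d ν).real E =
      1 - confProb d ν (fun φ => loopEdges φ = ∅ ∧ φ ∉ E) /
        confProb d ν (fun φ => loopEdges φ = ∅) := by
  classical
  set L := (cfg d ν).filter fun φ => loopEdges φ = ∅ with hL
  have hset : configurations d ν ∩ {φ | (configGraph φ).Loopless} = (L : Set _) := by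
    ext φ
    simp [hL, mem_cfg, configGraph_loopless_iff]
  have hlaw : looplessConfigLaw d ν = ProbabilityTheory.cond MeasureTheory.Measure.count (L : Set _) := by
    unfold looplessConfigLaw configLaw ProbabilityTheory.uniformOn
    rw [ProbabilityTheory.cond_cond_eq_cond_inter', hset]
    · exact (Set.toFinite _).measurableSet
    · exact (Set.toFinite _).measurableSet
    · exact (MeasureTheory.Measure.count_apply_lt_top.2 (Set.toFinite _)).ne
  have hE : (L : Set _) ∩ E = ((L.filter fun φ => φ ∈ E : Finset _) : Set _) := by
    ext φ; simp
  have hreal : (looplessConfigLaw d ν).real E =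
      ((L.filter fun φ => φ ∈ E).card : ℝ) / L.card := by
    rw [hlaw, MeasureTheory.measureReal_def, ProbabilityTheory.cond_apply L.measurableSet, hE,
      MeasureTheory.Measure.count_apply_finset, MeasureTheory.Measure.count_apply_finset,
      ENNReal.toReal_mul, ENNReal.toReal_inv]
    simp only [ENNReal.toReal_natCast]
    rw [div_eq_inv_mul]
  have hsplit := card_filter_add_card_filter_not (s := L) (fun φ => φ ∈ E)
  have hsplit' : ((L.filter fun φ => φ ∈ E).card : ℝ) + (L.filter fun φ => φ ∉ E).card = L.card := by
    exact_mod_cast hsplit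
  rw [confProb_eq_div] at h0 ⊢
  rw [confProb_eq_div, ← filter_filter, ← hL, hreal]
  rw [← hL] at h0
  have hc : (cfg d ν).card ≠ (0 : ℝ) := by
    intro h; rw [h, div_zero] at h0; exact lt_irrefl _ h0
  have hLc : (L.card : ℝ) ≠ 0 := by
    intro h; rw [h, zero_div] at h0; exact lt_irrefl _ h0
  field_simp
  linarith

/-! ### Choice of parameters and conclusion -/

/-- In a uniformly random configuration, the absence of both loops and a near perfect matching
has probability `O(1 / n)`. -/
theorem exists_confProb_loopless_no_matching_le : ∃ (N : ℕ) (C : ℝ), ∀ (n ν : ℕ) (d : Fin n → ℕ),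
    N ≤ n → (∀ i, 3 ≤ d i ∧ d i ≤ 4) → ∑ i, d i = 2 * ν →
    confProb d ν (fun φ => loopEdges φ = ∅ ∧ ¬ (configGraph φ).HasNearPerfectMatching) ≤ C / n := by
  classical
  obtain ⟨δ, hδ, C₁, hC₁⟩ := exists_confProb_dense_le
  -- α ≤ 3δ/4 makes pieces of small degree sum subject to sparsity, because 2ν ≤ 4n.
  set α := min (1 / 4) (3 * δ / 4) with hα
  have hα0 : 0 < α := lt_min (by norm_num) (by positivity)
  have hα1 : α ≤ 1 / 4 := min_le_left _ _
  have hαδ : α ≤ 3 * δ / 4 := min_le_right _ _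
  obtain ⟨ε₂, hε₂, C₂, hC₂⟩ := exists_confProb_small_boundary_le hα0 (by linarith)
  -- σ ≤ ε₂/4 bounds the boundaries 4|S| by ε₂n. With δn ≥ 50, σ ≤ δ/50 gives 25(σn + 1) ≤ δn.
  set σ := min (ε₂ / 4) (δ / 50) with hσ
  have hσ0 : 0 < σ := lt_min (by positivity) (by positivity)
  have hσε : σ ≤ ε₂ / 4 := min_le_left _ _
  have hσδ : σ ≤ δ / 50 := min_le_right _ _
  obtain ⟨ε, hε, C₃, hC₃⟩ := exists_confProb_edgesGoTo_le hσ0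
  -- Pieces with more than K vertices number at most n/K ≤ εn/2; the other half of εn is for the
  -- small cyclic sets.
  obtain ⟨K, hK⟩ := exists_nat_ge (2 / ε)
  have hK0 : 0 < K := by
    have : (0 : ℝ) < K := lt_of_lt_of_le (by positivity) hK
    exact_mod_cast this
  set C₄ := ∑ k ∈ range (K + 1), (16 : ℝ) ^ k with hC₄
  obtain ⟨N, hN⟩ := exists_nat_ge (50 / δ)
  refine ⟨N + 1, C₁ + C₂ + C₃ + 2 * C₄ / ε, fun n ν d hn hd hsum => ?_⟩
  have hn0 : 0 < n := by omega
  have hn' : (0 : ℝ) < n := by exact_mod_cast hn0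
  have hnN : (N : ℝ) ≤ n := by exact_mod_cast (by omega : N ≤ n)
  obtain ⟨hν1, hν2⟩ := card_le_of_degree hd hsum
  have hν2' : (ν : ℝ) ≤ 2 * n := by exact_mod_cast hν2
  have hδn : 50 ≤ δ * n := by
    have := hN.trans hnN
    rw [div_le_iff₀ hδ] at this
    linarith
  have b₁ := hC₁ n ν d hn0 hd hsum
  have b₂ := hC₂ n ν d hn0 hd hsum
  have b₃ := hC₃ n ν d hn0 hd hsum
  have b₄ := confProb_card_cyclic_mul_le hd hsum K (ε * n / 2)
  rw [← le_div_iff₀ (by positivity), ← hC₄] at b₄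
  have e₄ : C₄ / (ε * n / 2) = 2 * C₄ / ε / n := by field_simp
  rw [e₄] at b₄
  set E₁ : (Fin (2 * ν) → Fin n) → Prop := fun φ => ∃ X : Finset (Fin n), X.Nonempty ∧
    (X.card : ℝ) ≤ δ * n ∧ X.card + max 2 ((X.card + 24) / 25) ≤ (innerEdges φ X).card with hE₁
  set E₂ : (Fin (2 * ν) → Fin n) → Prop := fun φ => ∃ A : Finset (Fin n),
      ((touchingEdges φ A).card : ℝ) ≤ (innerEdges φ A).card + ε₂ * n ∧
      α * (2 * ν) < ((∑ i ∈ A, d i : ℕ) : ℝ) ∧ ((∑ i ∈ A, d i : ℕ) : ℝ) < (1 - α) * (2 * ν) with hE₂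
  set E₃ : (Fin (2 * ν) → Fin n) → Prop := fun φ => ∃ S T : Finset (Fin n), Disjoint S T ∧
    EdgesGoTo φ T S ∧ σ * n ≤ S.card ∧ (S.card : ℝ) ≤ T.card + ε * n with hE₃
  set E₄ : (Fin (2 * ν) → Fin n) → Prop := fun φ => ε * n / 2 ≤ ((univ.filter fun A : Finset (Fin n) =>
      2 ≤ A.card ∧ A.card ≤ K ∧ A.card ≤ (innerEdges φ A).card).card : ℝ) with hE₄
  have hcov : confProb d ν (fun φ => loopEdges φ = ∅ ∧ ¬ (configGraph φ).HasNearPerfectMatching) ≤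
      confProb d ν (fun φ => (E₁ φ ∨ E₂ φ) ∨ (E₃ φ ∨ E₄ φ)) := by
    refine confProb_mono ?_
    rintro φ hφ ⟨hl, hm⟩
    by_contra hcon
    simp only [not_or] at hcon
    obtain ⟨⟨n₁, n₂⟩, n₃, n₄⟩ := hcon
    apply hm
    have hKε : 2 ≤ K * ε := by rwa [div_le_iff₀ hε] at hK
    refine hasNearPerfectMatching_of_expansion hd hsum hφ (fun j hj => ?_)
      (x₀ := δ * n) (s₀ := σ * n) (μ := ε₂ * n) (α := α) (r₀ := ε * n) (r₁ := ε * n / 2)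
      (r₂ := ε * n / 2) (K := K) ?_ ?_ ?_ ?_ hK0 (by linarith) ?_ ?_ ?_ ?_
    · have : j ∈ loopEdges φ := by simpa [loopEdges] using hj
      rw [hl] at this
      exact notMem_empty _ this
    · nlinarith
    · nlinarith
    · nlinarith
    · nlinarith
    · intro X hX hXc
      by_contra h
      exact n₁ ⟨X, hX, hXc, not_lt.1 h⟩
    · intro A hA
      by_contra h
      rw [not_or, not_le, not_le] at h
      exact n₂ ⟨A, hA, h⟩
    · exact (not_le.1 n₄).le
    · intro S T hST hgo hs
      by_contra h
      exact n₃ ⟨S, T, hST, hgo, hs, not_lt.1 h⟩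
  have h₁₂ := confProb_or_le (d := d) E₁ E₂
  have h₃₄ := confProb_or_le (d := d) E₃ E₄
  have h := confProb_or_le (d := d) (fun φ => E₁ φ ∨ E₂ φ) (fun φ => E₃ φ ∨ E₄ φ)
  have e : (C₁ + C₂ + C₃ + 2 * C₄ / ε) / n = C₁ / n + C₂ / n + C₃ / n + 2 * C₄ / ε / n := by ring
  rw [e]
  linarith

theorem theorem2 :
    ∃ C : ℝ, ∀ (n : ℕ), 2 ≤ n → ∀ (d : Fin n → ℕ), (∀ i, 3 ≤ d i ∧ d i ≤ 4) →
      ∀ (ν : ℕ), ∑ i, d i = 2 * ν →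
        1 - C * (n : ℝ) ^ (-(3 / 4) : ℝ) ≤
          (looplessConfigLaw d ν).real {φ | (configGraph φ).HasNearPerfectMatching} := by
  obtain ⟨N, C, hC⟩ := exists_confProb_loopless_no_matching_le
  refine ⟨(N + 12 : ℕ) + |C| * (12 * 8 ^ 5), fun n hn d hd ν hsum => ?_⟩
  have hn' : (0 : ℝ) < n := by exact_mod_cast (by omega : 0 < n)
  have hn1 : (1 : ℝ) ≤ n := by exact_mod_cast (by omega : 1 ≤ n)
  have hinv : (n : ℝ)⁻¹ ≤ (n : ℝ) ^ (-(3 / 4) : ℝ) := by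
    rw [← Real.rpow_neg_one]
    exact Real.rpow_le_rpow_of_exponent_le hn1 (by norm_num)
  have hpow0 : 0 < (n : ℝ) ^ (-(3 / 4) : ℝ) := Real.rpow_pos_of_pos hn' _
  have hCabs : 0 ≤ |C| := abs_nonneg C
  -- Below the threshold the constant is large enough to make the lower bound nonpositive.
  rcases lt_or_ge n (N + 12) with hlt | hge
  · refine le_trans ?_ MeasureTheory.measureReal_nonneg
    have h1 : (n : ℝ) ≤ (N + 12 : ℕ) := by exact_mod_cast hlt.le
    have h2 : 1 ≤ (n : ℝ) * (n : ℝ) ^ (-(3 / 4) : ℝ) := by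
      calc (1 : ℝ) = n * (n : ℝ)⁻¹ := (mul_inv_cancel₀ hn'.ne').symm
        _ ≤ _ := by gcongr
    have h3 : (n : ℝ) * (n : ℝ) ^ (-(3 / 4) : ℝ) ≤
        ((N + 12 : ℕ) + |C| * (12 * 8 ^ 5)) * (n : ℝ) ^ (-(3 / 4) : ℝ) := by
      gcongr
      have : 0 ≤ |C| * (12 * 8 ^ 5) := by positivity
      linarith
    linarith
  · have hl := confProb_loopless_ge (by omega) hd hsum
    have hl0 : 0 < confProb d ν (fun φ => loopEdges φ = ∅) := lt_of_lt_of_le (by norm_num) hl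
    have hb := hC n ν d (by omega) hd hsum
    rw [looplessConfigLaw_real d _ hl0]
    have h1 : confProb d ν (fun φ => loopEdges φ = ∅ ∧
        φ ∉ {φ | (configGraph φ).HasNearPerfectMatching}) ≤ |C| / n :=
      hb.trans (by gcongr; exact le_abs_self C)
    have h2 : confProb d ν (fun φ => loopEdges φ = ∅ ∧
        φ ∉ {φ | (configGraph φ).HasNearPerfectMatching}) /
        confProb d ν (fun φ => loopEdges φ = ∅) ≤ |C| / n / (1 / (12 * 8 ^ 5)) := by gcongr
    have h3 : |C| / n / (1 / (12 * 8 ^ 5)) = |C| * (12 * 8 ^ 5) * (n : ℝ)⁻¹ := by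
      field_simp
    have h4 : |C| * (12 * 8 ^ 5) * (n : ℝ)⁻¹ ≤
        ((N + 12 : ℕ) + |C| * (12 * 8 ^ 5)) * (n : ℝ) ^ (-(3 / 4) : ℝ) := by
      gcongr
      have : (0 : ℝ) ≤ (N + 12 : ℕ) := by positivity
      linarith
    linarith
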